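/- Call a nonsquare integer $D\equiv 0$ or $1 \pmod 4$ a discriminant. Its conductor $f$ is the largest positive integer such that $f^2\mid D$ and $d_0:=D/f^2$ is a discriminant; $D$ is fundamental if $f=1$. For a negative discriminant $D$ let $H(D)$ be the group, under Gaussian composition, of strict equivalence classes of primitive positive definite integral binary quadratic forms of discriminant $D$, and let $G(D)=H(D)/H(D)^2$ be its genus group. A genus (an element of $G(D)$) represents $n$ if some form in some class belonging to it represents $n$; let $g(n,D)$ be the number of genera of discriminant $D$ representing the positive integer $n$. Write $n\mid D^\infty$ if the positive integer $n$ divides some power of $D$. Let $D<0$ be a discriminant with conductor $f$ and $d_0=D/f^2$. Then $|G(D)|=2^{t(D)}$ for a nonnegative integer $t(D)$, the series $v(D):=\sum_{n\mid D^\infty}\frac{g(n,D)}{n}$ converges, and $$v(D)=\frac{|D|}{\varphi(|D|)}\prod_{\substack{p\mid D\\ (\frac{d_0}{p})=-1}}\frac{1}{1+1/p}\;\sum_{m\mid f}\frac{2^{\,t(D)-t(D/m^2)}}{m^2}\prod_{p\mid f/m}\Bigl(1-\frac1p\Bigr)\prod_{\substack{p\mid f/m\\ (\frac{d_0}{p})=-1}}\Bigl(1+\frac1p\Bigr),$$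 where $p$ runs over primes, $m$ over positive divisors of $f$, $\varphi$ is Euler's function and $(\frac{d_0}{p})$ is the Kronecker symbol. In particular, if $D$ is fundamental, then $v(D)=|D|/\varphi(|D|)$. -/

import Mathlib

/-- A discriminant: a nonsquare integer congruent to `0` or `1` modulo `4`. -/
def IsDiscriminant (D : ℤ) : Prop :=
  ¬ IsSquare D ∧ (D % 4 = 0 ∨ D % 4 = 1)

/-- The conductor of a discriminant `D`: the largest positive integer `f` such that `f ^ 2`
divides `D` and `D / f ^ 2` is again a discriminant. (For a discriminant `D` the set below
contains `1` and is bounded by `|D|`.) -/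
noncomputable def discConductor (D : ℤ) : ℕ :=
  sSup {f : ℕ | 0 < f ∧ (f : ℤ) ^ 2 ∣ D ∧ IsDiscriminant (D / (f : ℤ) ^ 2)}

/-- A fundamental discriminant: a discriminant of conductor `1`. -/
def IsFundamentalDiscriminant (D : ℤ) : Prop :=
  IsDiscriminant D ∧ discConductor D = 1

/-- The discriminant `d₀ = D / f ^ 2`, where `f` is the conductor of `D`. -/
noncomputable def fundDisc (D : ℤ) : ℤ :=
  D / (discConductor D : ℤ) ^ 2

/-- The Kronecker symbol `(d / p)` for a discriminant `d` and a prime `p`. At `p = 2` it is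
`0` for even `d`, `1` for `d ≡ ±1 (mod 8)` and `-1` for `d ≡ ±3 (mod 8)`; for odd `p` it is
the Legendre symbol. -/
def kroneckerAtPrime (d : ℤ) (p : ℕ) : ℤ :=
  if p = 2 then ZMod.χ₈ (d : ZMod 8) else jacobiSym d p

/-- Primitive positive definite integral binary quadratic forms
`a x ^ 2 + b x y + c y ^ 2` of discriminant `D`. -/
@[ext]
structure PrimForm (D : ℤ) where
  a : ℤ
  b : ℤ
  c : ℤ
  disc_eq : b ^ 2 - 4 * a * c = D
  primitive : Int.gcd (Int.gcd a b) c = 1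
  posDef : ∀ x y : ℤ, (x ≠ 0 ∨ y ≠ 0) → 0 < a * x ^ 2 + b * x * y + c * y ^ 2

namespace PrimForm

/-- The value of a form at `(x, y)`. -/
def eval {D : ℤ} (F : PrimForm D) (x y : ℤ) : ℤ :=
  F.a * x ^ 2 + F.b * x * y + F.c * y ^ 2

/-- Strict (proper) equivalence: the forms differ by a substitution of determinant `1`. -/
def StrictEquiv {D : ℤ} (F G : PrimForm D) : Prop :=
  ∃ p q r s : ℤ, p * s - q * r = 1 ∧
    ∀ x y : ℤ, G.eval x y = F.eval (p * x + q * y) (r * x + s * y)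

theorem strictEquiv_equivalence (D : ℤ) :
    Equivalence (StrictEquiv : PrimForm D → PrimForm D → Prop) where
  refl F := ⟨1, 0, 0, 1, by norm_num, fun x y => by simp⟩
  symm := by
    rintro F G ⟨p, q, r, s, h, hG⟩
    refine ⟨s, -q, -r, p, by linarith, fun x y => ?_⟩
    rw [hG]
    have h1 : p * (s * x + -q * y) + q * (-r * x + p * y) = x := by
      linear_combination x * h
    have h2 : r * (s * x + -q * y) + s * (-r * x + p * y) = y := by
      linear_combination y * h
    rw [h1, h2]
  trans := by
    rintro F G K ⟨p, q, r, s, h, hG⟩ ⟨p', q', r', s', h', hK⟩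
    refine ⟨p * p' + q * r', p * q' + q * s', r * p' + s * r', r * q' + s * s', ?_,
      fun x y => ?_⟩
    · linear_combination (p' * s' - q' * r') * h + h'
    · rw [hK, hG]
      congr 1 <;> ring

/-- Strict equivalence as a setoid. -/
def strictSetoid (D : ℤ) : Setoid (PrimForm D) :=
  ⟨StrictEquiv, strictEquiv_equivalence D⟩

/-- Gaussian (direct) composition: `K` is composed of `F` and `G` if
`F(x, y) G(z, w) = K(X, Y)` for integral bilinear forms
`X = a₁ x z + b₁ x w + c₁ y z + d₁ y w` and `Y = a₂ x z + b₂ x w + c₂ y z + d₂ y w`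
with `a₁ b₂ - a₂ b₁ = F(1, 0)` and `a₁ c₂ - a₂ c₁ = G(1, 0)`. -/
def IsComposition {D : ℤ} (F G K : PrimForm D) : Prop :=
  ∃ a₁ b₁ c₁ d₁ a₂ b₂ c₂ d₂ : ℤ,
    (∀ x y z w : ℤ, F.eval x y * G.eval z w =
      K.eval (a₁ * x * z + b₁ * x * w + c₁ * y * z + d₁ * y * w)
        (a₂ * x * z + b₂ * x * w + c₂ * y * z + d₂ * y * w)) ∧
    a₁ * b₂ - a₂ * b₁ = F.eval 1 0 ∧ a₁ * c₂ - a₂ * c₁ = G.eval 1 0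

end PrimForm

/-- `H(D)`: the strict equivalence classes of primitive positive definite integral binary
quadratic forms of discriminant `D`. -/
def FormClass (D : ℤ) : Type :=
  Quotient (PrimForm.strictSetoid D)

namespace FormClass

/-- The strict equivalence class of a form. -/
def mk {D : ℤ} (F : PrimForm D) : FormClass D :=
  Quotient.mk (PrimForm.strictSetoid D) F

/-- `A * B = C` in the group `H(D)` under Gaussian composition. -/
def IsProduct {D : ℤ} (A B C : FormClass D) : Prop :=
  ∃ F G K : PrimForm D, mk F = A ∧ mk G = B ∧ mk K = C ∧ PrimForm.IsComposition F G K

/-- `B = A * S ^ 2` in `H(D)` for some `S`; that is, `A` and `B` lie in the same coset of the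
subgroup `H(D) ^ 2` of squares. -/
def SameGenus {D : ℤ} (A B : FormClass D) : Prop :=
  ∃ S T : FormClass D, IsProduct S S T ∧ IsProduct A T B

/-- A class represents `n` if its forms do. -/
def Represents {D : ℤ} (A : FormClass D) (n : ℕ) : Prop :=
  ∃ F : PrimForm D, mk F = A ∧ ∃ x y : ℤ, F.eval x y = (n : ℤ)

end FormClass

/-- The genus group `G(D) = H(D) / H(D) ^ 2`, as the set of cosets of the squares. -/
def Genus (D : ℤ) : Type :=
  Quot (FormClass.SameGenus : FormClass D → FormClass D → Prop)

/-- A genus represents `n` if at least one class in it does. -/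
def Genus.Represents {D : ℤ} (G : Genus D) (n : ℕ) : Prop :=
  ∃ A : FormClass D, Quot.mk FormClass.SameGenus A = G ∧ A.Represents n

/-- `t(D)`, the exponent in `|G(D)| = 2 ^ t(D)`. -/
noncomputable def genusExponent (D : ℤ) : ℕ :=
  Nat.log 2 (Nat.card (Genus D))

/-- `g(n, D)`, the number of genera of discriminant `D` that represent `n`. -/
noncomputable def genusRepCount (n : ℕ) (D : ℤ) : ℕ :=
  Nat.card {G : Genus D // G.Represents n}

/-- The positive integers `n` with `n ∣ D ^ ∞`, that is, dividing some power of `D`. -/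
def PowDivisor (D : ℤ) : Type :=
  {n : ℕ // 0 < n ∧ ∃ k : ℕ, (n : ℤ) ∣ D ^ k}

/-- `v(D) = ∑ g(n, D) / n` over all positive `n` dividing some power of `D`. -/
noncomputable def genusSum (D : ℤ) : ℝ :=
  ∑' n : PowDivisor D, (genusRepCount n.1 D : ℝ) / (n.1 : ℝ)

/-! ### Binary quadratic forms: construction, representation, reduction -/

/-! Genera are told apart by their values. Modulo rational squares, the values of a form prime to
`D` make up a coset of the subgroup P(D) of the values of the principal form, and composing with a
square does not move this coset. Conversely, forms with a common value class lie in one genus: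
within their genera both acquire the same squarefree leading coefficient, and two such forms differ
by an explicit square (`genus_eq_of_leading_eq_squarefree`). Hence G(D) is A / P(D), where A
consists of the value classes of all forms. It is finite by reduction and killed by 2, so its order
is a power of 2.

Next the conductor is changed. Let D = m² D'. A form of discriminant D with leading coefficient
prime to m can be brought to the shape (a, mb, m²c) with (a, b, c) of discriminant D'. Therefore A
is the same for D and D', P(D) has index 2^(t(D) - t(D')) in P(D'), and the forms of discriminant D
representing m²n have the same value classes as the forms of discriminant D' representing n
(`reprValues_mul_sq`). If n is prime to the conductor of D', the latter fill at most one coset of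
P(D'), which splits into 2^(t(D) - t(D')) cosets of P(D) (`genusRepCount_mul`).

Finally, every represented n is uniquely m²n' with m ∣ f and n' prime to f/m, and n' is represented
in discriminant (f/m)² d₀ exactly when every inert prime divides it to an even power. So g(n, D) is
a sum over m ∣ f with at most one nonzero term, and for each m the sum over n' is an Euler product:
the factor at p is 1 if p ∣ f/m, otherwise (1 - p⁻²)⁻¹ for inert p and (1 - p⁻¹)⁻¹ for the rest. -/

theorem Int.gcd_gcd_eq_one_iff (a b c : ℤ) :
    Int.gcd (Int.gcd a b) c = 1 ↔
      ∀ p : ℕ, p.Prime → (p : ℤ) ∣ a → (p : ℤ) ∣ b → (p : ℤ) ∣ c → False := by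
  constructor
  · intro h p hp ha hb hc
    have h1 : (p : ℤ) ∣ (Int.gcd a b : ℤ) := Int.dvd_coe_gcd ha hb
    have h2 : (p : ℤ) ∣ (Int.gcd (Int.gcd a b) c : ℤ) := Int.dvd_coe_gcd h1 hc
    rw [h] at h2
    exact hp.one_lt.ne' (by exact_mod_cast Int.eq_one_of_dvd_one (by positivity) h2)
  · intro h
    by_contra hne
    obtain ⟨p, hp, hpd⟩ := Nat.exists_prime_and_dvd hne
    have h0 : (p : ℤ) ∣ (Int.gcd (Int.gcd a b) c : ℤ) := by exact_mod_cast hpd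
    have h1 : (p : ℤ) ∣ (Int.gcd a b : ℤ) := h0.trans (Int.gcd_dvd_left ..)
    exact h p hp (h1.trans (Int.gcd_dvd_left ..)) (h1.trans (Int.gcd_dvd_right ..))
      (h0.trans (Int.gcd_dvd_right ..))

theorem Int.isCoprime_of_forall_prime {a b : ℤ}
    (h : ∀ p : ℕ, p.Prime → (p : ℤ) ∣ a → (p : ℤ) ∣ b → False) : IsCoprime a b := by
  rw [Int.isCoprime_iff_gcd_eq_one]
  by_contra hne
  obtain ⟨p, hp, hpd⟩ := Nat.exists_prime_and_dvd hne
  have h0 : (p : ℤ) ∣ (Int.gcd a b : ℤ) := by exact_mod_cast hpd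
  exact h p hp (h0.trans (Int.gcd_dvd_left ..)) (h0.trans (Int.gcd_dvd_right ..))

theorem Int.not_prime_dvd_of_isCoprime {a b : ℤ} (h : IsCoprime a b) {p : ℕ} (hp : p.Prime)
    (ha : (p : ℤ) ∣ a) (hb : (p : ℤ) ∣ b) : False := by
  have := h.isUnit_of_dvd' ha hb
  exact (Nat.prime_iff_prime_int.mp hp).not_isUnit this

namespace PrimForm

variable {D : ℤ}

/-- A form with positive leading coefficient and negative discriminant is positive definite. -/
def ofPos (hneg : D < 0) (a b c : ℤ) (ha : 0 < a) (hd : b ^ 2 - 4 * a * c = D)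
    (hp : ∀ p : ℕ, p.Prime → (p : ℤ) ∣ a → (p : ℤ) ∣ b → (p : ℤ) ∣ c → False) : PrimForm D where
  a := a
  b := b
  c := c
  disc_eq := hd
  primitive := (Int.gcd_gcd_eq_one_iff a b c).2 hp
  posDef := by
    intro x y hxy
    have key : 4 * a * (a * x ^ 2 + b * x * y + c * y ^ 2) = (2 * a * x + b * y) ^ 2 - D * y ^ 2 := by
      rw [← hd]; ring
    have h : 0 < (2 * a * x + b * y) ^ 2 - D * y ^ 2 := by
      by_cases hy : y = 0
      · subst hy
        have hx : x ≠ 0 := by simpa using hxy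
        have : 0 < x ^ 2 := by positivity
        have h2 : 0 < a ^ 2 * x ^ 2 := by positivity
        linear_combination 4 * h2
      · have : 0 < y ^ 2 := by positivity
        have := mul_pos (neg_pos.2 hneg) this
        linarith [sq_nonneg (2 * a * x + b * y)]
    rw [← key] at h
    exact pos_of_mul_pos_right h (by positivity)

theorem not_prime_dvd (F : PrimForm D) {p : ℕ} (hp : p.Prime) (ha : (p : ℤ) ∣ F.a)
    (hb : (p : ℤ) ∣ F.b) (hc : (p : ℤ) ∣ F.c) : False :=
  (Int.gcd_gcd_eq_one_iff _ _ _).1 F.primitive p hp ha hb hc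

theorem a_pos (F : PrimForm D) : 0 < F.a := by
  simpa using F.posDef 1 0 (by simp)

theorem eval_pos (F : PrimForm D) {x y : ℤ} (h : x ≠ 0 ∨ y ≠ 0) : 0 < F.eval x y :=
  F.posDef x y h

theorem eval_one_zero (F : PrimForm D) : F.eval 1 0 = F.a := by simp [eval]

theorem eval_mul (F : PrimForm D) (k x y : ℤ) : F.eval (k * x) (k * y) = k ^ 2 * F.eval x y := by
  simp only [eval]; ring

theorem four_mul_eval (F : PrimForm D) (x y : ℤ) :
    4 * F.a * F.eval x y = (2 * F.a * x + F.b * y) ^ 2 - D * y ^ 2 := by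
  simp only [eval]
  linear_combination -y ^ 2 * F.disc_eq

theorem four_mul_eval' (F : PrimForm D) (x y : ℤ) :
    4 * F.c * F.eval x y = (2 * F.c * y + F.b * x) ^ 2 - D * x ^ 2 := by
  simp only [eval]
  linear_combination -x ^ 2 * F.disc_eq

theorem mk_eq_iff {F G : PrimForm D} : FormClass.mk F = FormClass.mk G ↔ F.StrictEquiv G :=
  Quotient.eq (r := strictSetoid D)

theorem exists_eval_of_mk_eq {F G : PrimForm D} (h : FormClass.mk F = FormClass.mk G) (x y : ℤ) :
    ∃ x' y', F.eval x' y' = G.eval x y := by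
  obtain ⟨p, q, r, s, -, hG⟩ := mk_eq_iff.1 h
  exact ⟨_, _, (hG x y).symm⟩

/-- Substitution of an integral matrix of determinant `1` in a form. -/
theorem exists_subst (hneg : D < 0) (F : PrimForm D) (p q r s : ℤ) (h : p * s - q * r = 1) :
    ∃ G : PrimForm D, FormClass.mk F = FormClass.mk G ∧ G.a = F.eval p r ∧
      G.b = 2 * F.a * p * q + F.b * (p * s + q * r) + 2 * F.c * r * s := by
  have hpr : p ≠ 0 ∨ r ≠ 0 := by
    by_contra! hc
    simp [hc.1, hc.2] at h
  have hev : ∀ x y, F.eval p r * x ^ 2 +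
      (2 * F.a * p * q + F.b * (p * s + q * r) + 2 * F.c * r * s) * x * y + F.eval q s * y ^ 2
      = F.eval (p * x + q * y) (r * x + s * y) := by
    intro x y; simp only [eval]; ring
  refine ⟨ofPos hneg (F.eval p r) (2 * F.a * p * q + F.b * (p * s + q * r) + 2 * F.c * r * s)
    (F.eval q s) (F.eval_pos hpr) ?_ ?_, ?_, rfl, rfl⟩
  · simp only [eval]
    linear_combination (p * s - q * r + 1) * (F.b ^ 2 - 4 * F.a * F.c) * h + F.disc_eq
  · intro P hP ha hb hc
    -- By the inverse substitution, a common prime factor of the new coefficients divides every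
    -- value of `F`; the values at (1,0), (0,1), (1,1) then contradict primitivity.
    have hall : ∀ x y, (P : ℤ) ∣ F.eval x y := by
      intro x y
      have := hev (s * x - q * y) (-r * x + p * y)
      have e1 : p * (s * x - q * y) + q * (-r * x + p * y) = x := by linear_combination x * h
      have e2 : r * (s * x - q * y) + s * (-r * x + p * y) = y := by linear_combination y * h
      rw [e1, e2] at this
      rw [← this]
      exact dvd_add (dvd_add (ha.mul_right _) ((hb.mul_right _).mul_right _)) (hc.mul_right _)
    have h1 : (P : ℤ) ∣ F.a := by simpa [eval] using hall 1 0
    have h2 : (P : ℤ) ∣ F.c := by simpa [eval] using hall 0 1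
    have h3 : (P : ℤ) ∣ F.a + F.b + F.c := by simpa [eval] using hall 1 1
    refine F.not_prime_dvd hP h1 ?_ h2
    have : F.b = F.a + F.b + F.c - F.a - F.c := by ring
    rw [this]
    exact dvd_sub (dvd_sub h3 h1) h2
  · exact mk_eq_iff.2 ⟨p, q, r, s, h, fun x y => hev x y⟩

theorem exists_leading (hneg : D < 0) (F : PrimForm D) {x y : ℤ} (h : IsCoprime x y) :
    ∃ G : PrimForm D, FormClass.mk F = FormClass.mk G ∧ G.a = F.eval x y := by
  obtain ⟨u, v, huv⟩ := h
  obtain ⟨G, h1, h2, -⟩ := F.exists_subst hneg x (-v) y u (by linear_combination huv)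
  exact ⟨G, h1, h2⟩

theorem exists_shift (hneg : D < 0) (F : PrimForm D) (t : ℤ) :
    ∃ G : PrimForm D, FormClass.mk F = FormClass.mk G ∧ G.a = F.a ∧ G.b = F.b + 2 * F.a * t := by
  obtain ⟨G, h1, h2, h3⟩ := F.exists_subst hneg 1 t 0 1 (by ring)
  exact ⟨G, h1, by simpa [eval] using h2, by rw [h3]; ring⟩

theorem exists_leading_of_eval (hneg : D < 0) (F : PrimForm D) {x y n : ℤ} (h : F.eval x y = n)
    (hn : n ≠ 0) :
    ∃ (G : PrimForm D) (g : ℤ), FormClass.mk F = FormClass.mk G ∧ 0 < g ∧ n = g ^ 2 * G.a := by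
  have hxy : x ≠ 0 ∨ y ≠ 0 := by
    by_contra! hc
    simp [hc.1, hc.2, eval] at h
    exact hn h.symm
  have hg : 0 < Int.gcd x y := Int.gcd_pos_iff.2 hxy
  obtain ⟨x', hx'⟩ := Int.gcd_dvd_left (a := x) (b := y)
  obtain ⟨y', hy'⟩ := Int.gcd_dvd_right (a := x) (b := y)
  have hco : IsCoprime x' y' := by
    have hg' : (Int.gcd x y : ℤ) ≠ 0 := by exact_mod_cast hg.ne'
    rw [Int.isCoprime_iff_gcd_eq_one]
    have h1 : Int.gcd x y = Int.gcd x y * Int.gcd x' y' := by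
      have h2 : Int.gcd ((Int.gcd x y : ℤ) * x') ((Int.gcd x y : ℤ) * y') =
        (Int.gcd x y : ℤ).natAbs * Int.gcd x' y' := Int.gcd_mul_left ..
      rw [← hx', ← hy'] at h2
      simpa using h2
    exact Nat.eq_of_mul_eq_mul_left hg (by rw [← h1, mul_one])
  obtain ⟨G, h1, h2⟩ := F.exists_leading hneg hco
  refine ⟨G, Int.gcd x y, h1, by exact_mod_cast hg, ?_⟩
  rw [h2, ← eval_mul, ← hx', ← hy', h]

/-- A primitive form represents values coprime to any given nonzero integer. -/
theorem exists_eval_isCoprime (F : PrimForm D) {N : ℕ} (hN : N ≠ 0) :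
    ∃ x y : ℤ, IsCoprime (F.eval x y) N := by
  classical
  -- With these `x` and `y`, exactly one of the three terms survives modulo each `p ∣ N`: `a x²` if
  -- `p ∤ a`, `c y²` if `p ∣ a` and `p ∤ c`, and `b x y` if `p` divides both.
  let y : ℕ := ∏ p ∈ N.primeFactors.filter (fun q : ℕ => ¬ ((q : ℤ) ∣ F.a)), p
  let x : ℕ := ∏ p ∈ N.primeFactors.filter (fun q : ℕ => (q : ℤ) ∣ F.a ∧ ¬ ((q : ℤ) ∣ F.c)), p
  have hy : ∀ p : ℕ, p.Prime → p ∣ N → ((p : ℤ) ∣ (y : ℤ) ↔ ¬ ((p : ℤ) ∣ F.a)) := by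
    intro p hp hpN
    rw [Int.natCast_dvd_natCast, Prime.dvd_finsetProd_iff hp.prime]
    constructor
    · rintro ⟨q, hq, hpq⟩
      rw [Finset.mem_filter] at hq
      rw [(Nat.prime_dvd_prime_iff_eq hp (Nat.prime_of_mem_primeFactors hq.1)).1 hpq]
      exact hq.2
    · intro h
      exact ⟨p, by simp [hp, hpN, hN, h], dvd_rfl⟩
  have hx : ∀ p : ℕ, p.Prime → p ∣ N →
      ((p : ℤ) ∣ (x : ℤ) ↔ (p : ℤ) ∣ F.a ∧ ¬ ((p : ℤ) ∣ F.c)) := by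
    intro p hp hpN
    rw [Int.natCast_dvd_natCast, Prime.dvd_finsetProd_iff hp.prime]
    constructor
    · rintro ⟨q, hq, hpq⟩
      rw [Finset.mem_filter] at hq
      rw [(Nat.prime_dvd_prime_iff_eq hp (Nat.prime_of_mem_primeFactors hq.1)).1 hpq]
      exact hq.2
    · intro h
      exact ⟨p, by simp [hp, hpN, hN, h], dvd_rfl⟩
  refine ⟨x, y, Int.isCoprime_of_forall_prime fun p hp h1 h2 => ?_⟩
  have hpN : p ∣ N := by exact_mod_cast h2
  have hp' : Prime (p : ℤ) := Nat.prime_iff_prime_int.mp hp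
  have hx := hx p hp hpN
  have hy := hy p hp hpN
  simp only [eval] at h1
  by_cases ha : (p : ℤ) ∣ F.a
  · have hy' : ¬ (p : ℤ) ∣ (y : ℤ) := by tauto
    by_cases hc : (p : ℤ) ∣ F.c
    · have hx' : ¬ (p : ℤ) ∣ (x : ℤ) := by tauto
      have hb : ¬ (p : ℤ) ∣ F.b := fun hb => F.not_prime_dvd hp ha hb hc
      rw [dvd_add_left (hc.mul_right _), dvd_add_right (ha.mul_right _)] at h1
      rcases hp'.dvd_or_dvd h1 with h1 | h1
      · rcases hp'.dvd_or_dvd h1 with h1 | h1 <;> contradiction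
      · contradiction
    · have hx' : (p : ℤ) ∣ (x : ℤ) := by tauto
      rw [dvd_add_right (dvd_add (ha.mul_right _) ((hx'.mul_left _).mul_right _))] at h1
      rcases hp'.dvd_or_dvd h1 with h1 | h1
      · contradiction
      · exact hy' (hp'.dvd_of_dvd_pow h1)
  · have hy' : (p : ℤ) ∣ (y : ℤ) := by tauto
    have hx' : ¬ (p : ℤ) ∣ (x : ℤ) := by tauto
    rw [dvd_add_left ((dvd_pow hy' two_ne_zero).mul_left _), dvd_add_left (hy'.mul_left _)] at h1
    rcases hp'.dvd_or_dvd h1 with h1 | h1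
    · contradiction
    · exact hx' (hp'.dvd_of_dvd_pow h1)

theorem exists_leading_isCoprime (hneg : D < 0) (F : PrimForm D) {N : ℕ} (hN : N ≠ 0) :
    ∃ (G : PrimForm D), FormClass.mk F = FormClass.mk G ∧ IsCoprime G.a N := by
  -- The extra factor 2 keeps the value nonzero even when `N = 1`.
  obtain ⟨x, y, h⟩ := F.exists_eval_isCoprime (N := N * 2) (by positivity)
  have h0 : F.eval x y ≠ 0 := by
    intro h0
    rw [h0] at h
    have := Int.not_prime_dvd_of_isCoprime h Nat.prime_two (by simp) (by simp)
    exact this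
  obtain ⟨G, g, h1, -, h2⟩ := F.exists_leading_of_eval hneg rfl h0
  rw [h2] at h
  push_cast at h
  exact ⟨G, h1, (h.of_mul_left_right).of_mul_right_left⟩

end PrimForm

/-- Every class of forms contains a form with `|b| ≤ a ≤ c`. -/
theorem PrimForm.exists_reduced {D : ℤ} (hneg : D < 0) (F : PrimForm D) :
    ∃ G : PrimForm D, FormClass.mk F = FormClass.mk G ∧ |G.b| ≤ G.a ∧ G.a ≤ G.c := by
  classical
  -- Take the least leading coefficient in the class. A shift gives `|b| ≤ a`, and exchanging the
  -- variables shows `a ≤ c` by minimality.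
  let S : Set ℕ := {n | ∃ G : PrimForm D, FormClass.mk F = FormClass.mk G ∧ G.a = n}
  have hS : S.Nonempty := ⟨F.a.toNat, F, rfl, by rw [Int.toNat_of_nonneg F.a_pos.le]⟩
  obtain ⟨G, hG, hGa⟩ := Nat.sInf_mem hS
  have hmin : ∀ K : PrimForm D, FormClass.mk F = FormClass.mk K → G.a ≤ K.a := by
    intro K hK
    have : K.a.toNat ∈ S := ⟨K, hK, by rw [Int.toNat_of_nonneg K.a_pos.le]⟩
    have := Nat.sInf_le this
    rw [hGa]
    have := Int.toNat_of_nonneg K.a_pos.le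
    omega
  have ha := G.a_pos
  obtain ⟨K, hK1, hK2, hK3⟩ := G.exists_shift hneg (-((G.b + G.a) / (2 * G.a)))
  have hd := Int.emod_add_mul_ediv (G.b + G.a) (2 * G.a)
  have h1 := Int.emod_nonneg (G.b + G.a) (show 2 * G.a ≠ 0 by omega)
  have h2 := Int.emod_lt_of_pos (G.b + G.a) (show 0 < 2 * G.a by omega)
  refine ⟨K, hG.trans hK1, ?_, ?_⟩
  · rw [hK2, abs_le]
    constructor <;> linarith
  · obtain ⟨L, hL1, hL2, -⟩ := K.exists_subst hneg 0 (-1) 1 0 (by ring)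
    have := hmin L ((hG.trans hK1).trans hL1)
    rw [hK2]
    simpa [hL2, PrimForm.eval] using this

/-- In a reduced form `b² ≤ a² ≤ ac`, so `-D = 4ac - b²` bounds `a` and `b`, and these determine
`c`. -/
theorem FormClass.finite {D : ℤ} (hneg : D < 0) : Finite (FormClass D) := by
  classical
  let R := {p : ℤ × ℤ // p ∈ (Finset.Icc D (-D)) ×ˢ (Finset.Icc D (-D))}
  have hex : ∀ A : FormClass D, ∃ G : PrimForm D, A = FormClass.mk G ∧
      (G.a, G.b) ∈ (Finset.Icc D (-D)) ×ˢ (Finset.Icc D (-D)) := by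
    intro A
    obtain ⟨F, rfl⟩ := Quotient.exists_rep A
    obtain ⟨G, h1, h2, h3⟩ := F.exists_reduced hneg
    refine ⟨G, h1, ?_⟩
    have ha := G.a_pos
    have h4 : G.b ^ 2 ≤ G.a ^ 2 := sq_le_sq' (by linarith [neg_abs_le G.b]) ((le_abs_self _).trans h2)
    have h5 : G.a ^ 2 ≤ G.a * G.c := by nlinarith
    have h6 := G.disc_eq
    have h7 : G.a ≤ -D := by nlinarith
    rw [abs_le] at h2
    simp only [Finset.mem_product, Finset.mem_Icc]
    refine ⟨⟨?_, ?_⟩, ?_, ?_⟩ <;> linarith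
  choose f hf1 hf2 using hex
  refine Finite.of_injective (fun A => (⟨((f A).a, (f A).b), hf2 A⟩ : R)) ?_
  intro A B h
  simp only [Subtype.mk.injEq, Prod.mk.injEq] at h
  have hfe : f A = f B := by
    have hA := (f A).disc_eq
    have hB := (f B).disc_eq
    have hc : (f A).c = (f B).c := by
      rw [h.1, h.2] at hA
      have : 4 * (f B).a * (f A).c = 4 * (f B).a * (f B).c := by linarith
      exact mul_left_cancel₀ (by have := (f B).a_pos; positivity) this
    exact PrimForm.ext h.1 h.2 hc
  rw [hf1 A, hf1 B, hfe]

theorem Genus.finite {D : ℤ} (hneg : D < 0) : Finite (Genus D) := by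
  have := FormClass.finite hneg
  exact Quot.finite _

/-! ### Explicit compositions and equality of genera -/

/-- The genus of a form. -/
def PrimForm.genus {D : ℤ} (F : PrimForm D) : Genus D :=
  Quot.mk _ (FormClass.mk F)

namespace PrimForm

variable {D : ℤ}

theorem genus_congr {F G : PrimForm D} (h : FormClass.mk F = FormClass.mk G) :
    F.genus = G.genus := by
  rw [genus, genus, h]

theorem genus_eq_of_isComposition {F G S T : PrimForm D} (h1 : IsComposition S S T)
    (h2 : IsComposition F T G) : F.genus = G.genus :=
  Quot.sound ⟨FormClass.mk S, FormClass.mk T, ⟨S, S, T, rfl, rfl, rfl, h1⟩,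
    ⟨F, T, G, rfl, rfl, rfl, h2⟩⟩

/-- Dirichlet composition of concordant forms. -/
theorem isComposition_of_concordant {F G K : PrimForm D} {a₁ a₂ b c : ℤ}
    (hFa : F.a = a₁) (hFb : F.b = b) (hFc : F.c = a₂ * c)
    (hGa : G.a = a₂) (hGb : G.b = b) (hGc : G.c = a₁ * c)
    (hKa : K.a = a₁ * a₂) (hKb : K.b = b) (hKc : K.c = c) : IsComposition F G K := by
  refine ⟨1, 0, 0, -c, 0, a₁, a₂, b, fun x y z w => ?_, ?_, ?_⟩
  · simp only [eval, hFa, hFb, hFc, hGa, hGb, hGc, hKa, hKb, hKc]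
    ring
  · rw [eval_one_zero, hFa]; ring
  · rw [eval_one_zero, hGa]; ring

theorem isComposition_square {S T : PrimForm D} {a b c : ℤ} (hSa : S.a = a) (hSb : S.b = b)
    (hSc : S.c = a * c) (hTa : T.a = a ^ 2) (hTb : T.b = b) (hTc : T.c = c) :
    IsComposition S S T :=
  isComposition_of_concordant hSa hSb hSc hSa hSb hSc (by rw [hTa]; ring) hTb hTc

/-- A square factor of the leading coefficient that is coprime to the middle coefficient can be
moved to the last coefficient within the genus. -/
theorem exists_genus_eq_of_leading_mul_sq (hneg : D < 0) (F : PrimForm D) {e u : ℤ} (he : 0 < e)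
    (hu : 0 < u) (hF : F.a = e * u ^ 2) (hco : IsCoprime u F.b) :
    ∃ G : PrimForm D, F.genus = G.genus ∧ G.a = e := by
  have hd := F.disc_eq
  rw [hF] at hd
  -- `S` = (u, b, uec) has square `T` = (u², b, ec), and `G` = (e, b, u²c) composed with `T` is `F`
  -- = (eu², b, c). Coprimality of `u` and `b` makes them primitive.
  let S : PrimForm D := ofPos hneg u F.b (u * (e * F.c)) hu (by linear_combination hd)
    fun p hp h1 h2 _ => Int.not_prime_dvd_of_isCoprime hco hp h1 h2
  let T : PrimForm D := ofPos hneg (u ^ 2) F.b (e * F.c) (by positivity) (by linear_combination hd)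
    fun p hp h1 h2 _ => Int.not_prime_dvd_of_isCoprime hco hp
      ((Nat.prime_iff_prime_int.mp hp).dvd_of_dvd_pow h1) h2
  let G : PrimForm D := ofPos hneg e F.b (u ^ 2 * F.c) he (by linear_combination hd) fun p hp h1 h2 h3 => by
    rcases (Nat.prime_iff_prime_int.mp hp).dvd_or_dvd h3 with h | h
    · exact Int.not_prime_dvd_of_isCoprime hco hp
        ((Nat.prime_iff_prime_int.mp hp).dvd_of_dvd_pow h) h2
    · exact F.not_prime_dvd hp (by rw [hF]; exact h1.mul_right _) h2 h
  refine ⟨G, ?_, rfl⟩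
  refine (genus_eq_of_isComposition (S := S) (T := T) (F := G) (G := F) ?_ ?_).symm
  · exact isComposition_square rfl rfl rfl rfl rfl rfl
  · exact isComposition_of_concordant rfl rfl rfl rfl rfl rfl hF rfl rfl

/-- Two forms with the same squarefree leading coefficient lie in the same genus. -/
theorem genus_eq_of_leading_eq_squarefree (hneg : D < 0) (F G : PrimForm D) {e : ℤ}
    (hF : F.a = e) (hG : G.a = e) (hsq : Squarefree e) : F.genus = G.genus := by
  have he : 0 < e := hF ▸ F.a_pos
  have hdF := F.disc_eq
  have hdG := G.disc_eq
  rw [hF] at hdF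
  rw [hG] at hdG
  have hpar : ∃ X, F.b - G.b = 2 * X := by
    have h2 : Even (F.b ^ 2 - G.b ^ 2) := ⟨2 * e * (F.c - G.c), by linear_combination hdF - hdG⟩
    have : Even (F.b - G.b) := by
      rw [Int.even_sub, Int.even_pow' two_ne_zero, Int.even_pow' two_ne_zero] at h2
      rwa [Int.even_sub]
    obtain ⟨X, hX⟩ := this
    exact ⟨X, by rw [hX]; ring⟩
  obtain ⟨X, hX⟩ := hpar
  obtain ⟨Y, hY⟩ : ∃ Y, F.b + G.b = 2 * Y := ⟨F.b - X, by linarith⟩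
  have hXY : X * Y = e * (F.c - G.c) := by
    have : (2 * X) * (2 * Y) = 4 * e * (F.c - G.c) := by
      rw [← hX, ← hY]; linear_combination hdF - hdG
    linarith
  -- Split `e` so that the middle coefficients agree modulo `2 e₁` and are opposite modulo `2 e₂`.
  -- In terms of ideals, `F` and `G` share the factor of norm `e₁` and have conjugate factors of
  -- norm `e₂`, so they differ by the square of a class with leading coefficient `e₂`.
  obtain ⟨e₁, e₂, k, he₁, hee, hk, hco⟩ : ∃ e₁ e₂ k : ℤ, 0 < e₁ ∧ e = e₁ * e₂ ∧ X = e₁ * k ∧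
      IsCoprime e₂ k := by
    have hg : 0 < Int.gcd e X := Int.gcd_pos_of_ne_zero_left _ he.ne'
    obtain ⟨e₂, h2⟩ := Int.gcd_dvd_left (a := e) (b := X)
    obtain ⟨k, h3⟩ := Int.gcd_dvd_right (a := e) (b := X)
    refine ⟨Int.gcd e X, e₂, k, by exact_mod_cast hg, h2, h3, ?_⟩
    rw [Int.isCoprime_iff_gcd_eq_one]
    have h4 : Int.gcd ((Int.gcd e X : ℤ) * e₂) ((Int.gcd e X : ℤ) * k) =
      (Int.gcd e X : ℤ).natAbs * Int.gcd e₂ k := Int.gcd_mul_left ..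
    rw [← h2, ← h3] at h4
    exact Nat.eq_of_mul_eq_mul_left hg (by simpa using h4.symm)
  have he₂ : 0 < e₂ := by
    rw [hee] at he; exact pos_of_mul_pos_right he he₁.le
  have hco12 : IsCoprime e₁ e₂ := by
    refine Int.isCoprime_of_forall_prime fun p hp h1 h2 => ?_
    have := hsq p (by rw [hee]; exact mul_dvd_mul h1 h2)
    exact (Nat.prime_iff_prime_int.mp hp).not_isUnit this
  obtain ⟨h, hh⟩ : e₂ ∣ Y := by
    have : e₂ ∣ k * Y := ⟨F.c - G.c, by
      apply mul_left_cancel₀ he₁.ne'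
      rw [← mul_assoc, ← hk, hXY, hee]; ring⟩
    exact hco.dvd_of_dvd_mul_left this
  have hFb : F.b = e₁ * k + e₂ * h := by rw [← hk, ← hh]; linarith
  have hGb : G.b = e₂ * h - e₁ * k := by rw [← hk, ← hh]; linarith
  have hcoB : IsCoprime e₂ F.b := by
    rw [hFb]
    exact (IsCoprime.mul_right hco12.symm hco).add_mul_left_right h
  -- A Hensel lift: `l` is chosen so that `(F.b - 2 e₂ l)² ≡ D` modulo `4 e₂²`, which lets the form
  -- with leading coefficient `e₂` be squared by the concordant formula.
  obtain ⟨l, CT, hl⟩ : ∃ l CT : ℤ, F.b * l = e₁ * F.c + e₂ * (l ^ 2 - CT) := by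
    obtain ⟨r, s, hrs⟩ := hcoB
    refine ⟨s * (e₁ * F.c), (s * (e₁ * F.c)) ^ 2 + r * (e₁ * F.c), ?_⟩
    linear_combination (e₁ * F.c) * hrs
  have hcoB' : IsCoprime e₂ (F.b - 2 * e₂ * l) := by
    rw [show F.b - 2 * e₂ * l = F.b + e₂ * (-2 * l) by ring]
    exact hcoB.add_mul_left_right (-2 * l)
  obtain ⟨j, hj⟩ : e₂ ∣ k * l - F.c := by
    have : e₂ ∣ e₁ * (k * l - F.c) := ⟨l ^ 2 - CT - h * l, by
      rw [hFb] at hl; linear_combination hl⟩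
    exact hco12.symm.dvd_of_dvd_mul_left this
  have hdT : (F.b - 2 * e₂ * l) ^ 2 - 4 * e₂ * (e₂ * CT) = D := by
    rw [hee] at hdF; linear_combination hdF + (-4 * e₂) * hl
  let S : PrimForm D := ofPos hneg e₂ (F.b - 2 * e₂ * l) (e₂ * CT) he₂ hdT
    fun p hp h1 h2 _ => Int.not_prime_dvd_of_isCoprime hcoB' hp h1 h2
  let T : PrimForm D := ofPos hneg (e₂ ^ 2) (F.b - 2 * e₂ * l) CT (by positivity)
    (by linear_combination hdT)
    fun p hp h1 h2 _ => Int.not_prime_dvd_of_isCoprime hcoB' hp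
      ((Nat.prime_iff_prime_int.mp hp).dvd_of_dvd_pow h1) h2
  refine (genus_eq_of_isComposition (S := S) (T := T) (F := G) (G := F) ?_ ?_).symm
  · exact isComposition_square rfl rfl rfl rfl rfl rfl
  · have hGc : G.c = F.c - k * h := by
      have : e * (F.c - G.c) = e * (k * h) := by rw [← hXY, hk, hh, hee]; ring
      linarith [mul_left_cancel₀ he.ne' this]
    have hFc : F.c = k * l - e₂ * j := by linarith
    have hCT : e₂ * (CT - l ^ 2) = e₂ * (- e₁ * j - h * l) := by
      rw [hFb, hFc] at hl
      linear_combination hl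
    have hCT' : CT = l ^ 2 - e₁ * j - h * l := by linarith [mul_left_cancel₀ he₂.ne' hCT]
    -- The leading coefficients of `G` and `T` share the factor `e₂`, so the bilinear substitution
    -- is written out.
    refine ⟨e₂, -l, -k, j, 0, e₁, e₂, h - l, fun x y z w => ?_, ?_, ?_⟩
    · simp only [eval, T, ofPos, hF, hG, hGc, hFb, hGb, hFc, hCT', hee]
      ring
    · rw [eval_one_zero, hG, hee]; ring
    · simp only [eval, T, ofPos]; ring

theorem _root_.Nat.eq_of_squarefree_of_isSquare_mul {a b : ℕ} (ha : Squarefree a)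
    (hb : Squarefree b) (h : IsSquare (a * b)) : a = b := by
  have key : ∀ {a b p : ℕ}, Squarefree a → IsSquare (a * b) → p.Prime → p ∣ a → p ∣ b := by
    intro a b p ha ⟨c, hc⟩ hp hpa
    have : p ∣ c := by
      have : p ∣ c * c := hc ▸ hpa.mul_right b
      exact (hp.dvd_mul.1 this).elim id id
    exact Squarefree.dvd_of_squarefree_of_mul_dvd_mul_right ha (hc ▸ mul_dvd_mul this this)
  refine (Nat.Squarefree.ext_iff ha hb).2 fun p hp => ⟨key ha h hp, key hb (mul_comm a b ▸ h) hp⟩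

/-- A prime `p` divides the conductor of `D`, up to the nonsquare condition. -/
def _root_.DividesConductor (D : ℤ) (p : ℕ) : Prop :=
  ∃ D' : ℤ, D = (p : ℤ) ^ 2 * D' ∧ (D' % 4 = 0 ∨ D' % 4 = 1)

/-- `D / p² = (b/p)² - 4(ac/p²)` is again 0 or 1 modulo 4. Coprimality to the conductor is used
through this: it rules out such primes. -/
theorem _root_.DividesConductor.of_dvd {b a c : ℤ} {p : ℕ} (hD : b ^ 2 - 4 * a * c = D)
    (hb : (p : ℤ) ∣ b) (hac : (p : ℤ) ^ 2 ∣ a * c) : DividesConductor D p := by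
  obtain ⟨b, rfl⟩ := hb
  obtain ⟨k, hk⟩ := hac
  refine ⟨b ^ 2 - 4 * k, by linear_combination -hD - 4 * hk, ?_⟩
  rcases Int.even_or_odd' b with ⟨r, rfl | rfl⟩
  · left
    rw [show (2 * r) ^ 2 - 4 * k = 4 * (r ^ 2 - k) by ring]
    exact Int.mul_emod_right ..
  · right
    rw [show (2 * r + 1) ^ 2 - 4 * k = 1 + 4 * (r ^ 2 + r - k) by ring]
    simp

/-- The gcd of the variables is stripped first, then the square part `u²` of the leading
coefficient. A prime dividing both `u` and the middle coefficient would divide the conductor. -/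
theorem exists_squarefree_leading (hneg : D < 0) (F : PrimForm D) {x y : ℤ} {n : ℕ}
    (h : F.eval x y = n) (hn : n ≠ 0) (hc : ∀ p : ℕ, p.Prime → p ∣ n → ¬ DividesConductor D p) :
    ∃ (G : PrimForm D) (e s : ℕ), F.genus = G.genus ∧ G.a = e ∧ Squarefree e ∧ n = e * s ^ 2 := by
  obtain ⟨G, g, hFG, hg, hng⟩ := F.exists_leading_of_eval hneg h (by exact_mod_cast hn)
  obtain ⟨A, hA⟩ := Int.eq_ofNat_of_zero_le G.a_pos.le
  obtain ⟨e, u, hu, he⟩ := Nat.sq_mul_squarefree A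
  lift g to ℕ using hg.le
  rw [hA] at hng
  norm_cast at hng hg
  have hA0 : A ≠ 0 := by rintro rfl; simp_all
  have hu0 : u ≠ 0 := by rintro rfl; simp_all
  have he0 : e ≠ 0 := he.ne_zero
  have hGa : G.a = e * (u : ℤ) ^ 2 := by rw [hA, ← hu]; push_cast; ring
  obtain ⟨K, hK, hKa⟩ := G.exists_genus_eq_of_leading_mul_sq hneg (e := e) (u := u) (by positivity)
    (by positivity) hGa (by
      refine Int.isCoprime_of_forall_prime fun p hp h1 h2 => ?_
      refine hc p hp ?_ (DividesConductor.of_dvd G.disc_eq h2 ?_)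
      · rw [hng, ← hu]
        have : p ∣ u := by exact_mod_cast h1
        exact ((dvd_pow this two_ne_zero).mul_right e).mul_left _
      · rw [hGa]
        exact ((pow_dvd_pow_of_dvd h1 2).mul_left _).mul_right _)
  exact ⟨K, e, g * u, (genus_congr hFG).trans hK, hKa, he, by rw [hng, ← hu]; ring⟩

/-- Forms representing values in the same square class lie in the same genus, provided
these values are coprime to the conductor. -/
theorem genus_eq_of_isSquare_mul (hneg : D < 0) (F G : PrimForm D) {x y z w : ℤ} {n m : ℕ}
    (hF : F.eval x y = n) (hG : G.eval z w = m) (hn : n ≠ 0) (hm : m ≠ 0)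
    (hcn : ∀ p : ℕ, p.Prime → p ∣ n → ¬ DividesConductor D p)
    (hcm : ∀ p : ℕ, p.Prime → p ∣ m → ¬ DividesConductor D p)
    (hsq : IsSquare (n * m)) : F.genus = G.genus := by
  obtain ⟨F', e, s, hF1, hF2, hF3, hF4⟩ := F.exists_squarefree_leading hneg hF hn hcn
  obtain ⟨G', e', s', hG1, hG2, hG3, hG4⟩ := G.exists_squarefree_leading hneg hG hm hcm
  have hee : e = e' := by
    refine Nat.eq_of_squarefree_of_isSquare_mul hF3 hG3 ?_
    rw [← Rat.isSquare_natCast_iff]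
    have hs : (s : ℚ) ≠ 0 := by rintro h; simp_all
    have hs' : (s' : ℚ) ≠ 0 := by rintro h; simp_all
    obtain ⟨r, hr⟩ := hsq
    refine ⟨r / (s * s'), ?_⟩
    have : (e * s ^ 2 * (e' * s' ^ 2) : ℚ) = r * r := by rw [hF4, hG4] at hr; exact_mod_cast hr
    field_simp
    push_cast
    linear_combination this
  subst hee
  rw [hF1, hG1]
  exact genus_eq_of_leading_eq_squarefree hneg F' G' hF2 hG2 (Int.squarefree_natCast.2 hF3)

end PrimForm

/-! ### Square classes of values and the genus group -/

namespace PrimForm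

variable {D : ℤ}

theorem b_emod_two (F : PrimForm D) : F.b % 2 = D % 2 := by
  have h := F.disc_eq
  have h1 : Even (F.b ^ 2 - D) := ⟨2 * F.a * F.c, by linear_combination h⟩
  rw [Int.even_sub, Int.even_pow' two_ne_zero] at h1
  simp only [Int.even_iff] at h1
  omega

theorem exists_b_sub (F G : PrimForm D) : ∃ k, F.b - G.b = 2 * k := by
  have h1 := F.b_emod_two
  have h2 := G.b_emod_two
  exact ⟨(F.b - G.b) / 2, by omega⟩

theorem exists_b_eq (F : PrimForm D) : ∃ k, F.b = D + 2 * k := by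
  have h1 := F.b_emod_two
  exact ⟨(F.b - D) / 2, by omega⟩

/-- The values of `F`, `G` multiply to values of `K`. -/
def Composes (F G K : PrimForm D) : Prop :=
  ∀ x y z w : ℤ, ∃ X Y : ℤ, F.eval x y * G.eval z w = K.eval X Y

theorem IsComposition.composes {F G K : PrimForm D} (h : IsComposition F G K) :
    Composes F G K := by
  obtain ⟨_, _, _, _, _, _, _, _, h, -⟩ := h
  exact fun x y z w => ⟨_, _, h x y z w⟩

/-- Once the leading coefficients are coprime, Bézout shifts give both forms the same middle
coefficient, and they become concordant. -/
theorem exists_composes (hneg : D < 0) (F G : PrimForm D) :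
    ∃ F' G' K : PrimForm D, FormClass.mk F = FormClass.mk F' ∧ FormClass.mk G = FormClass.mk G' ∧
      Composes F' G' K := by
  obtain ⟨G₁, hG₁, hco⟩ := G.exists_leading_isCoprime hneg (N := F.a.toNat)
    (by have := F.a_pos; omega)
  rw [Int.toNat_of_nonneg F.a_pos.le] at hco
  obtain ⟨u, v, huv⟩ := hco
  obtain ⟨X, hX⟩ := exists_b_sub F G₁
  obtain ⟨F', hF', hFa, hFb⟩ := F.exists_shift hneg (-(X * v))
  obtain ⟨G', hG', hGa, hGb⟩ := G₁.exists_shift hneg (X * u)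
  have hb : F'.b = G'.b := by rw [hFb, hGb]; linear_combination hX - 2 * X * huv
  have hdF := F'.disc_eq
  have hdG := G'.disc_eq
  have hco : IsCoprime G'.a F'.a := ⟨u, v, by rw [hGa, hFa]; exact huv⟩
  have hac : F'.a * F'.c = G'.a * G'.c := by
    rw [← hb] at hdG; linarith
  obtain ⟨c, hc⟩ : G'.a ∣ F'.c := hco.dvd_of_dvd_mul_left ⟨_, hac⟩
  have hc' : G'.c = F'.a * c := by
    apply mul_left_cancel₀ G'.a_pos.ne'
    rw [← hac, hc]; ring
  let K : PrimForm D := ofPos hneg (F'.a * G'.a) F'.b c (mul_pos F'.a_pos G'.a_pos)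
    (by rw [hc] at hdF; linear_combination hdF) fun p hp h1 h2 h3 => by
      rcases (Nat.prime_iff_prime_int.mp hp).dvd_or_dvd h1 with h | h
      · exact F'.not_prime_dvd hp h h2 (hc ▸ h3.mul_left _)
      · exact G'.not_prime_dvd hp h (hb ▸ h2) (hc' ▸ h3.mul_left _)
  exact ⟨F', G', K, hF', hG₁.trans hG', (isComposition_of_concordant (K := K) rfl rfl hc rfl
    hb.symm hc' rfl rfl rfl).composes⟩

/-- The principal form of discriminant `D`. -/
def principal (hneg : D < 0) (h4 : D % 4 = 0 ∨ D % 4 = 1) : PrimForm D :=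
  ofPos hneg 1 D (D * (D - 1) / 4) one_pos
    (by
      have : 4 ∣ D * (D - 1) := by
        rcases h4 with h | h
        · exact (Int.dvd_of_emod_eq_zero h).mul_right _
        · exact (show (4 : ℤ) ∣ D - 1 by omega).mul_left _
      obtain ⟨j, hj⟩ := this
      rw [hj, Int.mul_ediv_cancel_left _ four_ne_zero]
      linear_combination hj)
    fun p hp h _ _ => (Nat.prime_iff_prime_int.mp hp).not_isUnit (isUnit_of_dvd_one h)

section principal

variable (hneg : D < 0) (h4 : D % 4 = 0 ∨ D % 4 = 1)

theorem principal_c {F : PrimForm D} {k : ℤ} (hk : F.b = D + 2 * k) :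
    (principal hneg h4).c = F.a * F.c - D * k - k ^ 2 := by
  have h1 := (principal hneg h4).disc_eq
  have h2 := F.disc_eq
  simp only [show (principal hneg h4).a = 1 from rfl, show (principal hneg h4).b = D from rfl] at h1
  rw [hk] at h2
  linarith

/-- After `x ↦ x - k y` the principal form is `x² + b x y + a c y²`, which is concordant with `F`.
-/
theorem principal_composes (F : PrimForm D) : Composes (principal hneg h4) F F := by
  obtain ⟨k, hk⟩ := F.exists_b_eq
  intro x y z w
  refine ⟨(x - k * y) * z - F.c * y * w, (x - k * y) * w + F.a * y * z + F.b * y * w, ?_⟩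
  simp only [eval, principal_c hneg h4 hk, show (principal hneg h4).a = 1 from rfl,
    show (principal hneg h4).b = D from rfl, hk]
  ring

/-- `F` has the same values as its inverse (a, -b, c), and the product of the two classes is
principal. -/
theorem composes_principal (F : PrimForm D) : Composes F F (principal hneg h4) := by
  obtain ⟨k, hk⟩ := F.exists_b_eq
  intro x y z w
  refine ⟨F.a * x * z + F.c * y * w + F.b * x * w + k * (y * z - x * w), y * z - x * w, ?_⟩
  simp only [eval, principal_c hneg h4 hk, show (principal hneg h4).a = 1 from rfl,
    show (principal hneg h4).b = D from rfl, hk]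
  ring

end principal

/-- The square classes, as a set of nonzero rationals, of the values of `F` coprime to `N`. -/
def values (N : ℕ) (F : PrimForm D) : Set ℚˣ :=
  {q | ∃ (x y : ℤ) (r : ℚˣ), IsCoprime (F.eval x y) N ∧ (q : ℚ) * (r : ℚ) ^ 2 = F.eval x y}

theorem values_congr {N : ℕ} {F G : PrimForm D} (h : FormClass.mk F = FormClass.mk G) :
    F.values N = G.values N := by
  have key : ∀ {F G : PrimForm D}, FormClass.mk F = FormClass.mk G → G.values N ⊆ F.values N := by
    rintro F G h q ⟨x, y, r, h1, h2⟩
    obtain ⟨x', y', h3⟩ := exists_eval_of_mk_eq h x y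
    exact ⟨x', y', r, h3 ▸ h1, h3 ▸ h2⟩
  exact (key h.symm).antisymm (key h)

theorem mul_mem_values {N : ℕ} {F G K : PrimForm D} (h : Composes F G K) {q q' : ℚˣ}
    (hq : q ∈ F.values N) (hq' : q' ∈ G.values N) : q * q' ∈ K.values N := by
  obtain ⟨x, y, r, h1, h2⟩ := hq
  obtain ⟨z, w, s, h3, h4⟩ := hq'
  obtain ⟨X, Y, hXY⟩ := h x y z w
  refine ⟨X, Y, r * s, hXY ▸ h1.mul_left h3, ?_⟩
  rw [← hXY]
  push_cast
  rw [← h2, ← h4]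
  ring

theorem inv_mem_values {N : ℕ} {F : PrimForm D} {q : ℚˣ} (hq : q ∈ F.values N) :
    q⁻¹ ∈ F.values N := by
  obtain ⟨x, y, r, h1, h2⟩ := hq
  refine ⟨x, y, q * r, h1, ?_⟩
  rw [← h2]
  push_cast
  field_simp

theorem mem_values_of_leading {N : ℕ} {F : PrimForm D} (h : IsCoprime F.a N) :
    ∃ q : ℚˣ, (q : ℚ) = F.a ∧ q ∈ F.values N := by
  have : (F.a : ℚ) ≠ 0 := by exact_mod_cast F.a_pos.ne'
  exact ⟨Units.mk0 _ this, rfl, 1, 0, 1, by rwa [eval_one_zero], by rw [eval_one_zero]; simp⟩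

theorem values_nonempty (hneg : D < 0) {N : ℕ} (hN : N ≠ 0) (F : PrimForm D) :
    (F.values N).Nonempty := by
  obtain ⟨G, h, hG⟩ := F.exists_leading_isCoprime hneg hN
  obtain ⟨q, -, hq⟩ := mem_values_of_leading hG
  exact ⟨q, values_congr h ▸ hq⟩

/-- A value class is realised, up to equivalence, by a leading coefficient. -/
theorem exists_leading_of_mem_values (hneg : D < 0) {N : ℕ} {F : PrimForm D} {q : ℚˣ}
    (hq : q ∈ F.values N) : ∃ (G : PrimForm D) (r : ℚˣ), FormClass.mk F = FormClass.mk G ∧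
      IsCoprime G.a N ∧ (q : ℚ) * (r : ℚ) ^ 2 = G.a := by
  obtain ⟨x, y, r, h1, h2⟩ := hq
  have h0 : F.eval x y ≠ 0 := by
    intro h0
    rw [h0] at h2
    simp at h2
  obtain ⟨G, g, hG, hg, hga⟩ := F.exists_leading_of_eval hneg rfl h0
  have hg' : (g : ℚ) ≠ 0 := by exact_mod_cast hg.ne'
  refine ⟨G, r / Units.mk0 (g : ℚ) hg', hG, ?_, ?_⟩
  · rw [hga] at h1
    exact h1.of_mul_left_right
  · rw [hga] at h2
    push_cast at h2
    simp only [Units.val_div_eq_div_val, Units.val_mk0]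
    field_simp
    linarith

end PrimForm

/-! ### Genera as cosets of the value classes of the principal form -/

section genusGroup

open PrimForm

variable {D : ℤ} (hneg : D < 0) (h4 : D % 4 = 0 ∨ D % 4 = 1) (N : ℕ)

/-- The square classes of the values of the principal form coprime to `N`. -/
def principalValues : Subgroup ℚˣ where
  carrier := (principal hneg h4).values N
  one_mem' := ⟨1, 0, 1, by rw [eval_one_zero]; exact isCoprime_one_left, by
    rw [eval_one_zero]; simp [principal, ofPos]⟩
  mul_mem' h h' := mul_mem_values (principal_composes hneg h4 _) h h'
  inv_mem' h := inv_mem_values h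

/-- The square classes of all the values of forms of discriminant `D` coprime to `N`. -/
def allValues : Subgroup ℚˣ where
  carrier := {q | ∃ F : PrimForm D, q ∈ F.values N}
  one_mem' := ⟨_, (principalValues hneg h4 N).one_mem⟩
  mul_mem' := by
    rintro q q' ⟨F, hF⟩ ⟨G, hG⟩
    obtain ⟨F', G', K, h1, h2, h3⟩ := exists_composes hneg F G
    exact ⟨K, mul_mem_values h3 (values_congr h1 ▸ hF) (values_congr h2 ▸ hG)⟩
  inv_mem' := by
    rintro q ⟨F, hF⟩
    exact ⟨F, inv_mem_values hF⟩

variable {N}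

theorem mem_allValues {q : ℚˣ} :
    q ∈ allValues hneg h4 N ↔ ∃ F : PrimForm D, q ∈ F.values N := Iff.rfl

theorem principalValues_le_allValues : principalValues hneg h4 N ≤ allValues hneg h4 N :=
  fun _ h => ⟨_, h⟩

/-- The two compositions above make `F.values N` a single coset of the principal value classes. -/
theorem mem_values_iff {F : PrimForm D} {q q' : ℚˣ} (hq : q ∈ F.values N) :
    q' ∈ F.values N ↔ q⁻¹ * q' ∈ principalValues hneg h4 N := by
  constructor
  · exact fun h => mul_mem_values (composes_principal hneg h4 F) (inv_mem_values hq) h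
  · intro h
    have := mul_mem_values (principal_composes hneg h4 F) h hq
    rwa [mul_comm, mul_inv_cancel_left] at this

theorem sq_mem_principalValues (q : ℚˣ) : q ^ 2 ∈ principalValues hneg h4 N :=
  ⟨1, 0, q⁻¹, by rw [eval_one_zero]; exact isCoprime_one_left, by
    rw [eval_one_zero]; simp [principal, ofPos]⟩

theorem not_dividesConductor_of_isCoprime {n : ℕ} (hDN : D ∣ N) (h : IsCoprime (n : ℤ) N)
    (p : ℕ) (hp : p.Prime) (hpn : p ∣ n) : ¬ DividesConductor D p := by
  rintro ⟨D', hD', -⟩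
  refine Int.not_prime_dvd_of_isCoprime h hp (by exact_mod_cast hpn) (dvd_trans ?_ hDN)
  rw [hD', sq, mul_assoc]
  exact dvd_mul_right _ _

include hneg in
/-- Forms with a common class of values lie in the same genus. -/
theorem PrimForm.genus_eq_of_mem_values (hDN : D ∣ N) {F G : PrimForm D} {q : ℚˣ}
    (hF : q ∈ F.values N) (hG : q ∈ G.values N) : F.genus = G.genus := by
  obtain ⟨F', r, hF1, hF2, hF3⟩ := exists_leading_of_mem_values hneg hF
  obtain ⟨G', s, hG1, hG2, hG3⟩ := exists_leading_of_mem_values hneg hG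
  rw [genus_congr hF1, genus_congr hG1]
  have ha := F'.a_pos
  have hb := G'.a_pos
  obtain ⟨n, hn⟩ := Int.eq_ofNat_of_zero_le ha.le
  obtain ⟨m, hm⟩ := Int.eq_ofNat_of_zero_le hb.le
  rw [hn] at hF2 hF3
  rw [hm] at hG2 hG3
  refine genus_eq_of_isSquare_mul hneg F' G' ((eval_one_zero F').trans hn)
    ((eval_one_zero G').trans hm) (by omega) (by omega)
    (not_dividesConductor_of_isCoprime hDN hF2) (not_dividesConductor_of_isCoprime hDN hG2) ?_
  rw [← Rat.isSquare_natCast_iff]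
  refine ⟨q * r * s, ?_⟩
  push_cast at hF3 hG3 ⊢
  rw [← hF3, ← hG3]
  ring

/-- The genera embed into the square classes modulo those of the principal form. -/
theorem exists_genus_embedding (hN : N ≠ 0) (hDN : D ∣ N) :
    ∃ φ : Genus D → ℚˣ ⧸ principalValues hneg h4 N, Function.Injective φ ∧
      ∀ (F : PrimForm D) (q : ℚˣ), q ∈ F.values N → φ F.genus = q := by
  choose v hv using fun F : PrimForm D => F.values_nonempty hneg hN
  have hmk : ∀ (F : PrimForm D) (q q' : ℚˣ), q ∈ F.values N → q' ∈ F.values N →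
      (q : ℚˣ ⧸ principalValues hneg h4 N) = q' := fun F q q' h h' =>
    QuotientGroup.eq.2 ((mem_values_iff hneg h4 h).1 h')
  let ψ : FormClass D → ℚˣ ⧸ principalValues hneg h4 N :=
    Quotient.lift (fun F => ((v F : ℚˣ) : ℚˣ ⧸ principalValues hneg h4 N)) fun F G h =>
      hmk F _ _ (hv F) (values_congr (mk_eq_iff.2 h) ▸ hv G)
  have hψ : ∀ (F : PrimForm D) (q : ℚˣ), q ∈ F.values N → ψ (FormClass.mk F) = q :=
    fun F q h => hmk F _ _ (hv F) h
  let φ : Genus D → ℚˣ ⧸ principalValues hneg h4 N := Quot.lift ψ (by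
    rintro A B ⟨S, T, ⟨S₁, S₂, T₁, rfl, h2, rfl, h4'⟩, ⟨F, T₂, G, rfl, h6, rfl, h8⟩⟩
    -- A square represents the trivial class `v · v⁻¹`, so composing with it preserves value
    -- classes; this makes `φ` well defined on genera.
    have h1 : (1 : ℚˣ) ∈ T₁.values N := by
      have := mul_mem_values h4'.composes (hv S₁)
        (values_congr h2.symm ▸ inv_mem_values (hv S₁))
      rwa [mul_inv_cancel] at this
    have h3 := mul_mem_values h8.composes (hv F) (values_congr h6.symm ▸ h1)
    rw [mul_one] at h3
    rw [hψ F _ (hv F), hψ G _ h3])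
  have hφ : ∀ (F : PrimForm D) (q : ℚˣ), q ∈ F.values N → φ F.genus = q := hψ
  refine ⟨φ, ?_, hφ⟩
  intro A B hAB
  obtain ⟨A, rfl⟩ := Quot.exists_rep A
  obtain ⟨F, rfl⟩ := Quotient.exists_rep A
  obtain ⟨B, rfl⟩ := Quot.exists_rep B
  obtain ⟨G, rfl⟩ := Quotient.exists_rep B
  change φ F.genus = φ G.genus at hAB
  change F.genus = G.genus
  rw [hφ F _ (hv F), hφ G _ (hv G)] at hAB
  refine genus_eq_of_mem_values hneg hDN ((mem_values_iff hneg h4 (hv F)).2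
    (QuotientGroup.eq.1 hAB)) (hv G)

theorem Genus.exists_form (A : Genus D) : ∃ F : PrimForm D, F.genus = A := by
  obtain ⟨A, rfl⟩ := Quot.exists_rep A
  obtain ⟨F, rfl⟩ := Quotient.exists_rep A
  exact ⟨F, rfl⟩

theorem Genus.represents_genus_iff {A : Genus D} {n : ℕ} :
    A.Represents n ↔ ∃ F : PrimForm D, F.genus = A ∧ ∃ x y : ℤ, F.eval x y = n := by
  constructor
  · rintro ⟨B, rfl, F, rfl, h⟩
    exact ⟨F, rfl, h⟩
  · rintro ⟨F, rfl, h⟩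
    exact ⟨_, rfl, F, rfl, h⟩

/-- The image of the embedding consists of the classes of `allValues`. -/
theorem Genus.card_eq_relIndex (hN : N ≠ 0) (hDN : D ∣ N) :
    Nat.card (Genus D) = (principalValues hneg h4 N).relIndex (allValues hneg h4 N) := by
  obtain ⟨φ, hφ, hφ'⟩ := exists_genus_embedding hneg h4 hN hDN
  rw [← QuotientGroup.ker_mk' (principalValues hneg h4 N), Subgroup.relIndex_ker]
  refine Nat.card_congr ((Equiv.ofInjective φ hφ).trans (Equiv.setCongr ?_))
  ext c
  constructor
  · rintro ⟨A, rfl⟩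
    obtain ⟨F, rfl⟩ := A.exists_form
    obtain ⟨q, hq⟩ := F.values_nonempty hneg hN
    exact ⟨q, ⟨F, hq⟩, (hφ' F q hq).symm⟩
  · rintro ⟨q, ⟨F, hq⟩, rfl⟩
    exact ⟨F.genus, hφ' F q hq⟩

-- Rational squares are principal value classes, so the quotient is a finite group of exponent
-- dividing 2; the logarithm in `genusExponent` is then exact.
include hneg h4 in
theorem Genus.card_eq_two_pow : Nat.card (Genus D) = 2 ^ genusExponent D := by
  have hN : D.natAbs ≠ 0 := by omega
  have hDN : D ∣ D.natAbs := by simp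
  have hcard := Genus.card_eq_relIndex hneg h4 hN hDN
  have : Finite (Genus D) := Genus.finite hneg
  have : Nonempty (Genus D) := ⟨(principal hneg h4).genus⟩
  have hpos : 0 < Nat.card (Genus D) := Nat.card_pos
  rw [← QuotientGroup.ker_mk' (principalValues hneg h4 _), Subgroup.relIndex_ker] at hcard
  have hfin : Finite (Subgroup.map (QuotientGroup.mk' (principalValues hneg h4 D.natAbs))
      (allValues hneg h4 D.natAbs)) := Nat.finite_of_card_ne_zero (hcard ▸ hpos.ne')
  have hp : IsPGroup 2 (Subgroup.map (QuotientGroup.mk' (principalValues hneg h4 D.natAbs))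
      (allValues hneg h4 D.natAbs)) := by
    rintro ⟨c, hc⟩
    obtain ⟨q, -, rfl⟩ := Subgroup.mem_map.1 hc
    refine ⟨1, Subtype.ext ?_⟩
    rw [pow_one, Subgroup.coe_pow, ← map_pow]
    exact (QuotientGroup.eq_one_iff _).2 (sq_mem_principalValues hneg h4 q)
  obtain ⟨t, ht⟩ := IsPGroup.iff_card.1 hp
  rw [ht] at hcard
  rw [genusExponent, hcard, Nat.log_pow one_lt_two]

end genusGroup

/-! ### Change of conductor -/

namespace PrimForm

variable {D D' : ℤ} {m : ℕ}

/-- A form whose leading coefficient is coprime to `m` is equivalent to one that comes from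
discriminant `D / m ^ 2`. -/
theorem exists_descent (hneg : D < 0) (hD : D = (m : ℤ) ^ 2 * D') (h4 : D' % 4 = 0 ∨ D' % 4 = 1)
    (hm : 0 < m) (F : PrimForm D) (hF : IsCoprime F.a m) :
    ∃ (G : PrimForm D) (G' : PrimForm D'), FormClass.mk F = FormClass.mk G ∧ G.a = F.a ∧
      G'.a = F.a ∧ G.b = m * G'.b ∧ G.c = m ^ 2 * G'.c := by
  have hm' : (0 : ℤ) < m := by exact_mod_cast hm
  have hneg' : D' < 0 := by
    by_contra! h
    have := mul_nonneg (sq_nonneg (m : ℤ)) h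
    omega
  obtain ⟨k, hk⟩ : ∃ k, F.b - m * D' = 2 * k := by
    have h1 : Even (F.b ^ 2 - (m * D') ^ 2 ) := by
      rw [Int.even_sub]
      have h2 : Even (F.b ^ 2 - D) := ⟨2 * F.a * F.c, by linear_combination F.disc_eq⟩
      rw [Int.even_sub] at h2
      rw [h2, hD]
      simp only [mul_pow, Int.even_mul, Int.even_pow' two_ne_zero]
    have h2 : Even (F.b - m * D') := by
      rw [Int.even_sub, Int.even_pow' two_ne_zero, Int.even_pow' two_ne_zero] at h1
      rwa [Int.even_sub]
    obtain ⟨k, hk⟩ := h2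
    exact ⟨k, by rw [hk]; ring⟩
  -- As `a` is a unit modulo `m`, a shift brings the middle coefficient to `m b'` with `b' ≡ D'`
  -- modulo 2. Then `b'² ≡ D'` modulo 4, so `m²` divides `a c`, hence `c`.
  obtain ⟨u, v, huv⟩ := id hF
  obtain ⟨G, hFG, hGa, hGb⟩ := F.exists_shift hneg (-k * u)
  have hGb' : G.b = m * (D' + 2 * (k * v)) := by
    rw [hGb]; linear_combination hk + (-2 * k) * huv
  have hd := G.disc_eq
  rw [hGb', hGa] at hd
  replace hd := hd.trans hD
  obtain ⟨j, hj⟩ : 4 ∣ (D' + 2 * (k * v)) ^ 2 - D' := by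
    have : 4 ∣ D' * (D' - 1) := by
      rcases h4 with h | h
      · exact (Int.dvd_of_emod_eq_zero h).mul_right _
      · exact (show (4 : ℤ) ∣ D' - 1 by omega).mul_left _
    obtain ⟨i, hi⟩ := this
    exact ⟨i + D' * (k * v) + (k * v) ^ 2, by linear_combination hi⟩
  have h1 : F.a * G.c = m ^ 2 * j := by
    have : 4 * (F.a * G.c) = 4 * (m ^ 2 * j) := by linear_combination (m : ℤ) ^ 2 * hj - hd
    exact mul_left_cancel₀ four_ne_zero this
  obtain ⟨c, hc⟩ : (m : ℤ) ^ 2 ∣ G.c := (hF.pow_right (n := 2)).symm.dvd_of_dvd_mul_left ⟨j, h1⟩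
  have hd' : (D' + 2 * (k * v)) ^ 2 - 4 * F.a * c = D' := by
    rw [hc] at h1
    have h2 : F.a * c = j := by
      apply mul_left_cancel₀ (pow_ne_zero 2 hm'.ne')
      linarith
    linear_combination hj - 4 * h2
  refine ⟨G, ofPos hneg' F.a (D' + 2 * (k * v)) c F.a_pos hd' ?_, hFG, hGa, rfl, hGb', hc⟩
  intro p hp ha hb hc'
  refine G.not_prime_dvd hp (hGa ▸ ha) ?_ ?_
  · rw [hGb']; exact hb.mul_left _
  · rw [hc]; exact hc'.mul_left _

theorem exists_ascent (hneg : D < 0) (hD : D = (m : ℤ) ^ 2 * D') (F : PrimForm D')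
    (hF : IsCoprime F.a m) :
    ∃ G : PrimForm D, G.a = F.a ∧ G.b = m * F.b ∧ G.c = m ^ 2 * F.c := by
  refine ⟨ofPos hneg F.a (m * F.b) (m ^ 2 * F.c) F.a_pos ?_ ?_, rfl, rfl, rfl⟩
  · rw [hD]; linear_combination (m : ℤ) ^ 2 * F.disc_eq
  · intro p hp ha hb hc
    have hp' := Nat.prime_iff_prime_int.mp hp
    have hpm : ¬ (p : ℤ) ∣ m := fun h => Int.not_prime_dvd_of_isCoprime hF hp ha h
    refine F.not_prime_dvd hp ha ((hp'.dvd_or_dvd hb).resolve_left hpm)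
      ((hp'.dvd_or_dvd hc).resolve_left fun h => hpm (hp'.dvd_of_dvd_pow h))

/-- The quotient `z / m` is a root of the monic polynomial `t² + s t - r`, hence an integer. -/
theorem _root_.Int.dvd_of_sq_add_mul_eq {m z s r : ℤ} (hm : m ≠ 0)
    (h : z ^ 2 + m * s * z = m ^ 2 * r) : m ∣ z := by
  have hg : (Int.gcd m z : ℤ) ≠ 0 := by
    exact_mod_cast (Int.gcd_pos_of_ne_zero_left _ hm).ne'
  obtain ⟨m', hm'⟩ := Int.gcd_dvd_left (a := m) (b := z)
  obtain ⟨z', hz'⟩ := Int.gcd_dvd_right (a := m) (b := z)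
  have hco : IsCoprime m' z' := by
    obtain ⟨u, v, huv⟩ : ∃ u v : ℤ, u * m + v * z = Int.gcd m z :=
      ⟨m.gcdA z, m.gcdB z, by rw [Int.gcd_eq_gcd_ab]; ring⟩
    refine ⟨u, v, mul_left_cancel₀ hg ?_⟩
    linear_combination huv - u * hm' - v * hz'
  have h1 : z' ^ 2 + m' * s * z' = m' ^ 2 * r := by
    apply mul_left_cancel₀ (pow_ne_zero 2 hg)
    generalize (Int.gcd m z : ℤ) = g at *
    subst hm' hz'
    linear_combination h
  have h2 : m' ∣ z' ^ 2 := ⟨m' * r - s * z', by linear_combination h1⟩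
  have h3 : IsUnit m' := hco.pow_right.isUnit_of_dvd' dvd_rfl h2
  obtain ⟨w, hw⟩ := h3.dvd (a := z')
  exact ⟨w, by linear_combination hz' + (Int.gcd m z : ℤ) * hw - w * hm'⟩

/-- If (a, mb, m²c) takes a value divisible by `m²`, the integrality argument applied to `z = a x`
gives `m ∣ a x`, hence `m ∣ x`. -/
theorem dvd_of_dvd_eval (hm : 0 < m) (F : PrimForm D') {G : PrimForm D} (ha : G.a = F.a)
    (hF : IsCoprime F.a m) (hb : G.b = m * F.b) (hc : G.c = m ^ 2 * F.c) {x y n : ℤ}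
    (h : G.eval x y = m ^ 2 * n) : ∃ x', F.eval x' y = n := by
  have hm' : (m : ℤ) ≠ 0 := by exact_mod_cast hm.ne'
  simp only [eval, ha, hb, hc] at h
  have h1 : (m : ℤ) ∣ F.a * x := by
    refine Int.dvd_of_sq_add_mul_eq (s := F.b * y) (r := F.a * (n - F.c * y ^ 2)) hm' ?_
    linear_combination F.a * h
  obtain ⟨x', rfl⟩ := hF.symm.dvd_of_dvd_mul_left h1
  refine ⟨x', mul_left_cancel₀ (pow_ne_zero 2 hm') ?_⟩
  simp only [eval]
  linear_combination h

theorem eval_ascent (F : PrimForm D') {G : PrimForm D} (ha : G.a = F.a)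
    (hb : G.b = m * F.b) (hc : G.c = m ^ 2 * F.c) (x y : ℤ) :
    G.eval (m * x) y = m ^ 2 * F.eval x y := by
  simp only [eval, ha, hb, hc]
  ring

/-- A prime that divides the conductor and a value of a form divides this value twice. -/
theorem sq_dvd_of_dvd_eval (hneg : D < 0) {p : ℕ} (hp : p.Prime) (hpD : DividesConductor D p)
    (F : PrimForm D) {x y n : ℤ} (h : F.eval x y = n) (hpn : (p : ℤ) ∣ n) : (p : ℤ) ^ 2 ∣ n := by
  obtain ⟨D', hD, h4⟩ := hpD
  obtain ⟨F₁, h1, h2⟩ := F.exists_leading_isCoprime hneg hp.ne_zero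
  obtain ⟨G, G', h3, h5, h6, h7, h8⟩ := exists_descent hneg hD h4 hp.pos F₁ h2
  obtain ⟨x, y, hxy⟩ := exists_eval_of_mk_eq (h1.trans h3).symm x y
  rw [h] at hxy
  have hp' := Nat.prime_iff_prime_int.mp hp
  rw [← hxy] at hpn ⊢
  simp only [eval, h5, h7, h8] at hpn ⊢
  -- In the shape (a, pb', p²c') the form is `a x²` modulo `p`, so `p ∣ x` and all three terms are
  -- divisible by `p²`.
  have hx : (p : ℤ) ∣ F₁.a * x ^ 2 := by
    have : F₁.a * x ^ 2 = F₁.a * x ^ 2 + p * G'.b * x * y + p ^ 2 * G'.c * y ^ 2 -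
      p * (G'.b * x * y + p * G'.c * y ^ 2) := by ring
    rw [this]
    exact dvd_sub hpn (dvd_mul_right _ _)
  obtain ⟨x', rfl⟩ := hp'.dvd_of_dvd_pow (h2.symm.dvd_of_dvd_mul_left hx)
  exact ⟨F₁.a * x' ^ 2 + G'.b * x' * y + G'.c * y ^ 2, by ring⟩

end PrimForm

/-! ### Genera in discriminants `D` and `D / m²` -/

section levels

open PrimForm

variable {D D' : ℤ} {m N : ℕ}

/-- The square classes of the values of those forms that represent `n`. -/
def reprValues (D : ℤ) (N n : ℕ) : Set ℚˣ :=
  {q | ∃ F : PrimForm D, q ∈ F.values N ∧ ∃ x y : ℤ, F.eval x y = n}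

/-- Realising `q` by a leading coefficient prime to `N`, hence to `m`, lets the form descend without
changing that coefficient, so the class `q` is kept. -/
theorem exists_descent_of_mem_values (hneg : D < 0) (hD : D = (m : ℤ) ^ 2 * D')
    (h4 : D' % 4 = 0 ∨ D' % 4 = 1) (hm : 0 < m) (hmN : m ∣ N) {F : PrimForm D} {q : ℚˣ}
    (hq : q ∈ F.values N) : ∃ F' : PrimForm D', q ∈ F'.values N ∧
      ∀ x y n : ℤ, F.eval x y = m ^ 2 * n → ∃ x' y', F'.eval x' y' = n := by
  obtain ⟨F₁, r, h1, h2, h3⟩ := exists_leading_of_mem_values hneg hq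
  have h2' : IsCoprime F₁.a m := h2.of_isCoprime_of_dvd_right (by exact_mod_cast hmN)
  obtain ⟨G, G', h5, h6, h7, h8, h9⟩ := exists_descent hneg hD h4 hm F₁ h2'
  refine ⟨G', ⟨1, 0, r, ?_, ?_⟩, ?_⟩
  · rwa [eval_one_zero, h7]
  · rw [h3, eval_one_zero, h7]
  · intro x y n h
    obtain ⟨x, y, hxy⟩ := exists_eval_of_mk_eq (h1.trans h5).symm x y
    obtain ⟨x', hx'⟩ := dvd_of_dvd_eval hm G' (h6.trans h7.symm) (h7 ▸ h2') h8 h9 (hxy.trans h)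
    exact ⟨x', y, hx'⟩

theorem exists_ascent_of_mem_values (hneg : D < 0) (hneg' : D' < 0) (hD : D = (m : ℤ) ^ 2 * D')
    (hmN : m ∣ N) {F : PrimForm D'} {q : ℚˣ}
    (hq : q ∈ F.values N) : ∃ G : PrimForm D, q ∈ G.values N ∧
      ∀ x y n : ℤ, F.eval x y = n → ∃ x' y', G.eval x' y' = m ^ 2 * n := by
  obtain ⟨F₁, r, h1, h2, h3⟩ := exists_leading_of_mem_values hneg' hq
  have h2' : IsCoprime F₁.a m := h2.of_isCoprime_of_dvd_right (by exact_mod_cast hmN)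
  obtain ⟨G, h5, h6, h7⟩ := exists_ascent hneg hD F₁ h2'
  refine ⟨G, ⟨1, 0, r, ?_, ?_⟩, ?_⟩
  · rwa [eval_one_zero, h5]
  · rw [h3, eval_one_zero, h5]
  · intro x y n h
    obtain ⟨x, y, hxy⟩ := exists_eval_of_mk_eq h1.symm x y
    rw [← h, ← hxy]
    exact ⟨_, _, eval_ascent F₁ h5 h6 h7 x y⟩

theorem reprValues_mul_sq (hneg : D < 0) (hneg' : D' < 0) (hD : D = (m : ℤ) ^ 2 * D')
    (h4 : D' % 4 = 0 ∨ D' % 4 = 1) (hm : 0 < m) (hmN : m ∣ N) (n : ℕ) :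
    reprValues D N (m ^ 2 * n) = reprValues D' N n := by
  ext q
  constructor
  · rintro ⟨F, hq, x, y, h⟩
    obtain ⟨F', h1, h2⟩ := exists_descent_of_mem_values hneg hD h4 hm hmN hq
    exact ⟨F', h1, h2 x y n (by rw [h]; push_cast; rfl)⟩
  · rintro ⟨F, hq, x, y, h⟩
    obtain ⟨G, h1, h2⟩ := exists_ascent_of_mem_values hneg hneg' hD hmN hq
    obtain ⟨x', y', h3⟩ := h2 x y n h
    exact ⟨G, h1, x', y', by rw [h3]; push_cast; rfl⟩

theorem allValues_eq (hneg : D < 0) (hneg' : D' < 0) (h4D : D % 4 = 0 ∨ D % 4 = 1)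
    (h4 : D' % 4 = 0 ∨ D' % 4 = 1) (hD : D = (m : ℤ) ^ 2 * D') (hm : 0 < m) (hmN : m ∣ N) :
    allValues hneg h4D N = allValues hneg' h4 N := by
  ext q
  rw [mem_allValues, mem_allValues]
  constructor
  · rintro ⟨F, hq⟩
    obtain ⟨F', h1, -⟩ := exists_descent_of_mem_values hneg hD h4 hm hmN hq
    exact ⟨F', h1⟩
  · rintro ⟨F, hq⟩
    obtain ⟨G, h1, -⟩ := exists_ascent_of_mem_values hneg hneg' hD hmN hq
    exact ⟨G, h1⟩

/-- The order of discriminant `D` lies in that of discriminant `D'`, and the principal forms are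
their norm forms. -/
theorem principalValues_le (hneg : D < 0) (hneg' : D' < 0) (h4D : D % 4 = 0 ∨ D % 4 = 1)
    (h4 : D' % 4 = 0 ∨ D' % 4 = 1) (hD : D = (m : ℤ) ^ 2 * D') :
    principalValues hneg h4D N ≤ principalValues hneg' h4 N := by
  have hdd := (principal hneg h4D).disc_eq
  have hdd' := (principal hneg' h4).disc_eq
  change D ^ 2 - 4 * 1 * (principal hneg h4D).c = D at hdd
  change D' ^ 2 - 4 * 1 * (principal hneg' h4).c = D' at hdd'
  obtain ⟨k, hk⟩ : ∃ k, D - m * D' = 2 * k := by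
    have : Even (D - m * D') := by
      rw [Int.even_sub, hD, Int.even_mul, Int.even_mul, Int.even_pow' two_ne_zero]
    obtain ⟨k, hk⟩ := this
    exact ⟨k, by rw [hk]; ring⟩
  rintro q ⟨x, y, r, h1, h2⟩
  have key : (principal hneg h4D).eval x y = (principal hneg' h4).eval (x + k * y) (m * y) := by
    have : 4 * (principal hneg h4D).eval x y =
        4 * (principal hneg' h4).eval (x + k * y) (m * y) := by
      simp only [eval, show (principal hneg h4D).a = 1 from rfl,
        show (principal hneg h4D).b = D from rfl, show (principal hneg' h4).a = 1 from rfl,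
        show (principal hneg' h4).b = D' from rfl]
      linear_combination -y ^ 2 * hdd + m ^ 2 * y ^ 2 * hdd' - hD * y ^ 2 +
        hk * (4 * x * y + y ^ 2 * (D + m * D' + 2 * k))
    exact mul_left_cancel₀ four_ne_zero this
  exact ⟨x + k * y, m * y, r, key ▸ h1, key ▸ h2⟩

/-- Multiplicativity of the index in P(D) ≤ P(D') ≤ A, with A common to both discriminants. -/
theorem relIndex_principalValues (hneg : D < 0) (hneg' : D' < 0) (h4D : D % 4 = 0 ∨ D % 4 = 1)
    (h4 : D' % 4 = 0 ∨ D' % 4 = 1) (hD : D = (m : ℤ) ^ 2 * D') (hm : 0 < m) (hmN : m ∣ N)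
    (hN : N ≠ 0) (hDN : D ∣ N) :
    (principalValues hneg h4D N).relIndex (principalValues hneg' h4 N) * 2 ^ genusExponent D' =
      2 ^ genusExponent D := by
  have hDN' : D' ∣ N := (Dvd.intro_left _ hD.symm).trans hDN
  rw [← Genus.card_eq_two_pow hneg h4D, ← Genus.card_eq_two_pow hneg' h4,
    Genus.card_eq_relIndex hneg h4D hN hDN, Genus.card_eq_relIndex hneg' h4 hN hDN',
    allValues_eq hneg hneg' h4D h4 hD hm hmN]
  exact Subgroup.relIndex_mul_relIndex _ _ _ (principalValues_le hneg hneg' h4D h4 hD)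
    (principalValues_le_allValues hneg' h4)

/-- The forms representing an integer coprime to the conductor make up at most one genus. -/
theorem reprValues_eq_values (hneg : D < 0) (h4 : D % 4 = 0 ∨ D % 4 = 1) (hN : N ≠ 0)
    (hDN : D ∣ N) {F : PrimForm D} {x y : ℤ} {n : ℕ} (hn : n ≠ 0) (hF : F.eval x y = n)
    (hc : ∀ p : ℕ, p.Prime → p ∣ n → ¬ DividesConductor D p) :
    reprValues D N n = F.values N := by
  ext q
  constructor
  · rintro ⟨G, hq, z, w, hG⟩
    have hFG : F.genus = G.genus := genus_eq_of_isSquare_mul hneg F G hF hG hn hn hc hc ⟨n, rfl⟩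
    obtain ⟨φ, -, hφ⟩ := exists_genus_embedding hneg h4 hN hDN
    obtain ⟨q', hq'⟩ := F.values_nonempty hneg hN
    refine (mem_values_iff hneg h4 hq').2 (QuotientGroup.eq.1 ?_)
    rw [← hφ F q' hq', ← hφ G q hq, hFG]
  · exact fun hq => ⟨F, hq, x, y, hF⟩

theorem genusRepCount_eq_card (hneg : D < 0) (h4 : D % 4 = 0 ∨ D % 4 = 1) (hN : N ≠ 0)
    (hDN : D ∣ N) (n : ℕ) : genusRepCount n D = Nat.card
      ((QuotientGroup.mk : ℚˣ → ℚˣ ⧸ principalValues hneg h4 N) '' reprValues D N n) := by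
  obtain ⟨φ, hφ, hφ'⟩ := exists_genus_embedding hneg h4 hN hDN
  have h1 : ((QuotientGroup.mk : ℚˣ → ℚˣ ⧸ principalValues hneg h4 N) '' reprValues D N n) =
      φ '' {G : Genus D | G.Represents n} := by
    ext c
    constructor
    · rintro ⟨q, ⟨F, hq, h⟩, rfl⟩
      exact ⟨F.genus, Genus.represents_genus_iff.2 ⟨F, rfl, h⟩, hφ' F q hq⟩
    · rintro ⟨A, hA, rfl⟩
      obtain ⟨F, rfl, h⟩ := Genus.represents_genus_iff.1 hA
      obtain ⟨q, hq⟩ := F.values_nonempty hneg hN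
      exact ⟨q, ⟨F, hq, h⟩, (hφ' F q hq).symm⟩
  rw [h1, Nat.card_image_of_injective hφ]
  rfl

theorem genusRepCount_eq_zero_iff (hneg : D < 0) (n : ℕ) :
    genusRepCount n D = 0 ↔ ∀ (F : PrimForm D) (x y : ℤ), F.eval x y ≠ n := by
  have := Genus.finite hneg
  rw [genusRepCount, Nat.card_eq_zero]
  constructor
  · rintro (h | h) F x y hF
    · exact h.false ⟨F.genus, Genus.represents_genus_iff.2 ⟨F, rfl, x, y, hF⟩⟩
    · exact h.not_finite inferInstance
  · intro h
    refine Or.inl ⟨fun ⟨A, hA⟩ => ?_⟩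
    obtain ⟨F, -, x, y, hF⟩ := Genus.represents_genus_iff.1 hA
    exact h F x y hF

/-- The number of genera representing `m ^ 2 * n` when `n` is represented in discriminant
`D / m ^ 2` and coprime to the conductor of `D / m ^ 2`. -/
theorem genusRepCount_mul (hneg : D < 0) (h4D : D % 4 = 0 ∨ D % 4 = 1) (hneg' : D' < 0)
    (h4 : D' % 4 = 0 ∨ D' % 4 = 1) (hD : D = (m : ℤ) ^ 2 * D') (hm : 0 < m) {n : ℕ} (hn : n ≠ 0)
    (hc : ∀ p : ℕ, p.Prime → p ∣ n → ¬ DividesConductor D' p) {F : PrimForm D'} {x y : ℤ}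
    (hF : F.eval x y = n) :
    genusRepCount (m ^ 2 * n) D * 2 ^ genusExponent D' = 2 ^ genusExponent D := by
  have hN : D.natAbs ≠ 0 := by omega
  have hDN : D ∣ D.natAbs := by simp
  have hmN : m ∣ D.natAbs := by
    rw [← Int.natCast_dvd, hD, sq, mul_assoc]
    exact dvd_mul_right _ _
  have hDN' : D' ∣ D.natAbs := (Dvd.intro_left _ hD.symm).trans hDN
  rw [← relIndex_principalValues hneg hneg' h4D h4 hD hm hmN hN hDN,
    genusRepCount_eq_card hneg h4D hN hDN, reprValues_mul_sq hneg hneg' hD h4 hm hmN,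
    reprValues_eq_values hneg' h4 hN hDN' hn hF hc]
  obtain ⟨q, hq⟩ := F.values_nonempty hneg' hN
  congr 1
  have hrel := Subgroup.relIndex_ker (principalValues hneg' h4 D.natAbs)
    (QuotientGroup.mk' (principalValues hneg h4D D.natAbs))
  rw [QuotientGroup.ker_mk'] at hrel
  rw [hrel]
  -- The value classes in question form one coset `q P(D')`; modulo P(D) it has as many elements as
  -- P(D') / P(D).
  have h1 : ((QuotientGroup.mk : ℚˣ → ℚˣ ⧸ principalValues hneg h4D D.natAbs) ''
      F.values D.natAbs) = (fun c => (q : ℚˣ ⧸ principalValues hneg h4D D.natAbs) * c) ''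
      (Subgroup.map (QuotientGroup.mk' (principalValues hneg h4D D.natAbs))
        (principalValues hneg' h4 D.natAbs) : Set (ℚˣ ⧸ principalValues hneg h4D D.natAbs)) := by
    ext c
    constructor
    · rintro ⟨q', hq', rfl⟩
      refine ⟨_, ⟨q⁻¹ * q', (mem_values_iff hneg' h4 hq).1 hq', rfl⟩, ?_⟩
      simp
    · rintro ⟨_, ⟨v, hv, rfl⟩, rfl⟩
      exact ⟨q * v, (mem_values_iff hneg' h4 hq).2 (by simpa using hv), rfl⟩
  rw [h1, Nat.card_image_of_injective (mul_right_injective _)]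
  rfl

end levels

/-! ### The conductor, and the integers represented by some form -/

theorem DividesConductor.sq_mul_of_dvd {d : ℤ} (h4 : d % 4 = 0 ∨ d % 4 = 1) {k p : ℕ}
    (h : p ∣ k) : DividesConductor ((k : ℤ) ^ 2 * d) p := by
  obtain ⟨j, rfl⟩ := h
  refine ⟨(j : ℤ) ^ 2 * d, by push_cast; ring, ?_⟩
  rcases Nat.even_or_odd' j with ⟨i, rfl | rfl⟩
  · left
    push_cast
    rw [show (2 * (i : ℤ)) ^ 2 * d = 4 * (i ^ 2 * d) by ring]
    exact Int.mul_emod_right ..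
  · push_cast
    rw [show (2 * (i : ℤ) + 1) ^ 2 * d = d + 4 * ((i ^ 2 + i) * d) by ring]
    simpa using h4

theorem DividesConductor.of_sq_mul {d : ℤ} (h4 : d % 4 = 0 ∨ d % 4 = 1) {k p : ℕ} (hp : p.Prime)
    (hpk : ¬ p ∣ k) (h : DividesConductor ((k : ℤ) ^ 2 * d) p) : DividesConductor d p := by
  obtain ⟨D', hD, h4'⟩ := h
  have hco : IsCoprime ((p : ℤ) ^ 2) ((k : ℤ) ^ 2) :=
    (Nat.isCoprime_iff_coprime.2 ((Nat.Prime.coprime_iff_not_dvd hp).2 hpk)).pow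
  obtain ⟨d', hd'⟩ := hco.dvd_of_dvd_mul_left ⟨D', hD⟩
  have hD' : D' = (k : ℤ) ^ 2 * d' := by
    have hp0 : ((p : ℤ) ^ 2) ≠ 0 := pow_ne_zero 2 (by exact_mod_cast hp.ne_zero)
    apply mul_left_cancel₀ hp0
    rw [← hD, hd']; ring
  refine ⟨d', hd', ?_⟩
  -- Either `p = 2` and `k` is odd, or `p` is odd. Odd squares are 1 modulo 4, so the congruence
  -- passes to `d'` from `D' = k² d'` or from `d = p² d'`.
  rcases Nat.even_or_odd' p with ⟨i, hi | hi⟩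
  · obtain ⟨j, hj⟩ : Odd k := by
      rw [← Nat.not_even_iff_odd, even_iff_two_dvd]
      have : p = 2 := by
        rcases hp.eq_one_or_self_of_dvd 2 ⟨i, hi⟩ with h | h <;> omega
      rwa [this] at hpk
    rw [hD', hj] at h4'
    push_cast at h4'
    rw [show (2 * (j : ℤ) + 1) ^ 2 * d' = d' + 4 * ((j ^ 2 + j) * d') by ring] at h4'
    simpa using h4'
  · rw [hd', hi] at h4
    push_cast at h4
    rw [show (2 * (i : ℤ) + 1) ^ 2 * d' = d' + 4 * ((i ^ 2 + i) * d') by ring] at h4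
    simpa using h4

theorem discConductor_mem {D : ℤ} (hD : IsDiscriminant D) :
    (0 < discConductor D ∧ (discConductor D : ℤ) ^ 2 ∣ D ∧
      IsDiscriminant (D / (discConductor D : ℤ) ^ 2)) ∧
    ∀ f : ℕ, 0 < f → (f : ℤ) ^ 2 ∣ D → IsDiscriminant (D / (f : ℤ) ^ 2) →
      f ≤ discConductor D := by
  have hD0 : D ≠ 0 := by
    rintro rfl
    exact hD.1 (IsSquare.zero)
  have hbdd : BddAbove {f : ℕ | 0 < f ∧ (f : ℤ) ^ 2 ∣ D ∧ IsDiscriminant (D / (f : ℤ) ^ 2)} := by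
    refine ⟨D.natAbs, ?_⟩
    rintro f ⟨-, h, -⟩
    exact Nat.le_of_dvd (Int.natAbs_pos.2 hD0)
      (Int.natCast_dvd.1 ((dvd_pow_self _ two_ne_zero).trans h))
  have hmem := Nat.sSup_mem (s := {f : ℕ | 0 < f ∧ (f : ℤ) ^ 2 ∣ D ∧
    IsDiscriminant (D / (f : ℤ) ^ 2)}) ⟨1, one_pos, by simp, by simpa using hD⟩ hbdd
  exact ⟨hmem, fun f h1 h2 h3 => le_csSup hbdd ⟨h1, h2, h3⟩⟩

section conductor

variable {D : ℤ} (hD : IsDiscriminant D) (hneg : D < 0)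

include hD

theorem discConductor_pos : 0 < discConductor D := (discConductor_mem hD).1.1

theorem discConductor_sq_mul_fundDisc : (discConductor D : ℤ) ^ 2 * fundDisc D = D :=
  Int.mul_ediv_cancel' (discConductor_mem hD).1.2.1

theorem fundDisc_emod_four : fundDisc D % 4 = 0 ∨ fundDisc D % 4 = 1 :=
  (discConductor_mem hD).1.2.2.2

include hneg

theorem fundDisc_neg : fundDisc D < 0 := by
  have h := discConductor_sq_mul_fundDisc hD
  by_contra! hc
  have := mul_nonneg (sq_nonneg (discConductor D : ℤ)) hc
  omega

/-- Otherwise `f p` would exceed the conductor `f`; the nonsquare condition is automatic for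
negative numbers. -/
theorem not_dividesConductor_fundDisc {p : ℕ} (hp : p.Prime) :
    ¬ DividesConductor (fundDisc D) p := by
  rintro ⟨d, hd, h4⟩
  have h0 := discConductor_sq_mul_fundDisc hD
  have hf := discConductor_pos hD
  have hfp : 0 < discConductor D * p := Nat.mul_pos hf hp.pos
  have hD' : D = ((discConductor D * p : ℕ) : ℤ) ^ 2 * d := by
    push_cast
    linear_combination -h0 + (discConductor D : ℤ) ^ 2 * hd
  have hneg' : d < 0 := by
    by_contra! hc
    have := mul_nonneg (sq_nonneg ((discConductor D * p : ℕ) : ℤ)) hc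
    omega
  have hle := (discConductor_mem hD).2 (discConductor D * p) hfp ⟨d, hD'⟩ (by
    have : D / ((discConductor D * p : ℕ) : ℤ) ^ 2 = d :=
      Int.ediv_eq_of_eq_mul_right (pow_ne_zero 2 (by exact_mod_cast hfp.ne')) hD'
    rw [this]
    exact ⟨not_isSquare_of_neg hneg', h4⟩)
  have := hp.two_le
  nlinarith

theorem not_dividesConductor_sq_mul_fundDisc {k p : ℕ} (hp : p.Prime) (hpk : ¬ p ∣ k) :
    ¬ DividesConductor ((k : ℤ) ^ 2 * fundDisc D) p := fun h =>
  not_dividesConductor_fundDisc hD hneg hp (h.of_sq_mul (fundDisc_emod_four hD) hp hpk)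

end conductor

/-! ### Inert primes, and square roots of the discriminant -/

section inert

variable {d : ℤ} {p : ℕ}

theorem emod_eight_of_kroneckerAtPrime_two (h4 : d % 4 = 0 ∨ d % 4 = 1) :
    kroneckerAtPrime d 2 = -1 ↔ d % 8 = 5 := by
  rw [kroneckerAtPrime, if_pos rfl, ZMod.χ₈_int_eq_if_mod_eight]
  split_ifs <;> constructor <;> intro h <;> first | omega | contradiction

theorem dvd_of_jacobiSym_eq_neg_one (hp : p.Prime) (h : jacobiSym d p = -1) {s t : ℤ}
    (hst : (p : ℤ) ∣ s ^ 2 - d * t ^ 2) : (p : ℤ) ∣ t := by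
  have := Fact.mk hp
  by_contra ht
  have ht' : (t : ZMod p) ≠ 0 := by rwa [Ne, ZMod.intCast_zmod_eq_zero_iff_dvd]
  rw [← ZMod.intCast_zmod_eq_zero_iff_dvd] at hst
  push_cast at hst
  refine ZMod.nonsquare_of_jacobiSym_eq_neg_one h ⟨(s : ZMod p) / t, ?_⟩
  field_simp
  linear_combination -hst

/-- The form is anisotropic modulo an inert prime. For `p = 2`, `D ≡ 5` modulo 8 makes all
coefficients odd, and `x² + xy + y²` is even only for even `x`, `y`. For odd `p`, complete the
square and use that `d` is a nonresidue. -/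
theorem PrimForm.dvd_of_inert {D : ℤ} (h4 : d % 4 = 0 ∨ d % 4 = 1) (hp : p.Prime) {k : ℕ}
    (hpk : ¬ p ∣ k) (hD : D = (k : ℤ) ^ 2 * d) (hk : kroneckerAtPrime d p = -1) (F : PrimForm D)
    {x y : ℤ} (h : (p : ℤ) ∣ F.eval x y) : (p : ℤ) ∣ x ∧ (p : ℤ) ∣ y := by
  have hp' := Nat.prime_iff_prime_int.mp hp
  have hpk' : ¬ (p : ℤ) ∣ k := by exact_mod_cast hpk
  by_cases h2 : p = 2
  · subst h2
    rw [emod_eight_of_kroneckerAtPrime_two h4] at hk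
    obtain ⟨j, hj⟩ : Odd k := by rwa [← Nat.not_even_iff_odd, even_iff_two_dvd]
    obtain ⟨i, hi⟩ := Int.even_mul_succ_self (j : ℤ)
    have hD8 : D % 8 = 5 := by
      rw [hD, hj]
      push_cast
      rw [show (2 * (j : ℤ) + 1) ^ 2 * d = d + 8 * (i * d) by linear_combination 4 * d * hi]
      omega
    have hb : Odd F.b := by
      have := F.b_emod_two
      rw [Int.odd_iff]; omega
    have hac : Odd (F.a * F.c) := by
      obtain ⟨b, hb⟩ := hb
      obtain ⟨l, hl⟩ := Int.even_mul_succ_self b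
      have := F.disc_eq
      rw [hb] at this
      have h3 : 4 * (F.a * F.c) = 8 * l + 1 - D := by linear_combination -this + 4 * hl
      rw [Int.odd_iff]; omega
    rw [Int.odd_mul] at hac
    have h5 : Even (F.eval x y) := even_iff_two_dvd.2 h
    have ha' : ¬ Even F.a := Int.not_even_iff_odd.2 hac.1
    have hc' : ¬ Even F.c := Int.not_even_iff_odd.2 hac.2
    have hb' : ¬ Even F.b := Int.not_even_iff_odd.2 hb
    simp only [eval, Int.even_add, Int.even_mul, Int.even_pow' two_ne_zero, ha', hb', hc',
      false_or] at h5
    rw [Nat.cast_ofNat, ← even_iff_two_dvd, ← even_iff_two_dvd]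
    tauto
  · rw [kroneckerAtPrime, if_neg h2] at hk
    have key : ∀ s t : ℤ, (p : ℤ) ∣ s ^ 2 - D * t ^ 2 → (p : ℤ) ∣ t := by
      intro s t hst
      rw [show s ^ 2 - D * t ^ 2 = s ^ 2 - d * (k * t) ^ 2 by rw [hD]; ring] at hst
      exact (hp'.dvd_or_dvd (dvd_of_jacobiSym_eq_neg_one hp hk hst)).resolve_left hpk'
    exact ⟨key _ _ (F.four_mul_eval' x y ▸ h.mul_left _),
      key _ _ (F.four_mul_eval x y ▸ h.mul_left _)⟩

theorem PrimForm.even_factorization_of_inert {D : ℤ} (h4 : d % 4 = 0 ∨ d % 4 = 1) (hp : p.Prime)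
    {k : ℕ} (hpk : ¬ p ∣ k) (hD : D = (k : ℤ) ^ 2 * d) (hk : kroneckerAtPrime d p = -1)
    (F : PrimForm D) : ∀ {n : ℕ} {x y : ℤ}, n ≠ 0 → F.eval x y = n → Even (n.factorization p) := by
  intro n
  induction n using Nat.strong_induction_on with
  | _ n ih =>
    intro x y hn h
    by_cases hpn : p ∣ n
    · obtain ⟨⟨x', rfl⟩, ⟨y', rfl⟩⟩ :=
        F.dvd_of_inert h4 hp hpk hD hk (x := x) (y := y) (by rw [h]; exact_mod_cast hpn)
      rw [eval_mul] at h
      obtain ⟨n', rfl⟩ : p ^ 2 ∣ n := by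
        have : ((p ^ 2 : ℕ) : ℤ) ∣ n := ⟨_, by rw [← h]; push_cast; rfl⟩
        exact_mod_cast this
      have hn' : n' ≠ 0 := by rintro rfl; simp at hn
      have hp0 : p ≠ 0 := hp.ne_zero
      have h' : F.eval x' y' = n' := by
        have hp2 : ((p : ℤ) ^ 2) ≠ 0 := pow_ne_zero 2 (by exact_mod_cast hp0)
        apply mul_left_cancel₀ hp2
        rw [h]; push_cast; rfl
      have hlt : n' < p ^ 2 * n' := by
        have := hp.two_le
        have : 4 ≤ p ^ 2 := by nlinarith
        have := Nat.pos_of_ne_zero hn'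
        nlinarith
      rw [Nat.factorization_mul (pow_ne_zero 2 hp0) hn', Nat.factorization_pow]
      simp only [Finsupp.coe_add, Finsupp.coe_smul, Pi.add_apply, Pi.smul_apply,
        hp.factorization_self]
      exact Even.add (by decide) (ih n' hlt hn' h')
    · rw [Nat.factorization_eq_zero_of_not_dvd hpn]
      exact Even.zero

theorem exists_sq_sub_of_prime (h4 : d % 4 = 0 ∨ d % 4 = 1) (hp : p.Prime) {k : ℕ}
    (hpk : ¬ p ∣ k) (hk : kroneckerAtPrime d p ≠ -1) :
    ∃ b : ℤ, 4 * (p : ℤ) ∣ b ^ 2 - (k : ℤ) ^ 2 * d := by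
  by_cases h2 : p = 2
  · subst h2
    rw [Ne, emod_eight_of_kroneckerAtPrime_two h4] at hk
    have : d % 8 = 0 ∨ d % 8 = 4 ∨ d % 8 = 1 := by omega
    rcases this with h | h | h
    · exact ⟨0, by
        obtain ⟨c, hc⟩ : (8 : ℤ) ∣ d := by omega
        exact ⟨-(k ^ 2 * c), by rw [hc]; push_cast; ring⟩⟩
    · exact ⟨2 * k, by
        obtain ⟨c, hc⟩ : (8 : ℤ) ∣ d - 4 := by omega
        exact ⟨-(k ^ 2 * c), by push_cast; linear_combination -(k : ℤ) ^ 2 * hc⟩⟩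
    · exact ⟨k, by
        obtain ⟨c, hc⟩ : (8 : ℤ) ∣ d - 1 := by omega
        exact ⟨-(k ^ 2 * c), by push_cast; linear_combination -(k : ℤ) ^ 2 * hc⟩⟩
  · have := Fact.mk hp
    rw [kroneckerAtPrime, if_neg h2, ← jacobiSym.legendreSym.to_jacobiSym] at hk
    obtain ⟨r, hr⟩ : IsSquare (d : ZMod p) := by
      by_contra hc
      exact hk ((legendreSym.eq_neg_one_iff p).2 hc)
    obtain ⟨r, rfl⟩ := ZMod.intCast_surjective r
    have hr' : (p : ℤ) ∣ r ^ 2 - d := by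
      rw [← ZMod.intCast_zmod_eq_zero_iff_dvd]
      push_cast
      rw [hr]; ring
    have hodd : p % 2 = 1 := (hp.eq_two_or_odd).resolve_left h2
    -- Adding the odd `p` if necessary makes `s ≡ d` modulo 2, whence `s² ≡ d` modulo 4.
    obtain ⟨s, hs1, hs2⟩ : ∃ s : ℤ, (p : ℤ) ∣ s ^ 2 - d ∧ (s - d) % 2 = 0 := by
      rcases Int.emod_two_eq_zero_or_one (r - d) with h | h
      · exact ⟨r, hr', h⟩
      · refine ⟨r + p, ?_, by omega⟩
        rw [show (r + (p : ℤ)) ^ 2 - d = (r ^ 2 - d) + p * (2 * r + p) by ring]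
        exact dvd_add hr' (dvd_mul_right _ _)
    have hs4 : (4 : ℤ) ∣ s ^ 2 - d := by
      obtain ⟨i, hi⟩ : (2 : ℤ) ∣ s - d := Int.dvd_of_emod_eq_zero hs2
      have : 4 ∣ d * (d - 1) := by
        rcases h4 with h | h
        · exact (Int.dvd_of_emod_eq_zero h).mul_right _
        · exact (show (4 : ℤ) ∣ d - 1 by omega).mul_left _
      obtain ⟨j, hj⟩ := this
      exact ⟨i ^ 2 + d * i + j, by rw [show s = d + 2 * i by linarith]; linear_combination hj⟩
    have hco : IsCoprime (4 : ℤ) p := by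
      have : Nat.Coprime (2 ^ 2) p := Nat.Coprime.pow_left 2
        ((Nat.coprime_primes Nat.prime_two hp).2 (Ne.symm h2))
      exact_mod_cast Nat.isCoprime_iff_coprime.2 this
    refine ⟨k * s, ?_⟩
    rw [show ((k : ℤ) * s) ^ 2 - k ^ 2 * d = k ^ 2 * (s ^ 2 - d) by ring]
    exact (hco.mul_dvd hs4 hs1).mul_left _

/-- Chinese remaindering: `x` and `y` have equal parity, so the common factor 4 is no obstruction.
-/
theorem exists_sq_sub_mul {D a b x y : ℤ} (hab : IsCoprime a b) (hx : 4 * a ∣ x ^ 2 - D)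
    (hy : 4 * b ∣ y ^ 2 - D) : ∃ z : ℤ, 4 * (a * b) ∣ z ^ 2 - D := by
  obtain ⟨u, v, huv⟩ := id hab
  obtain ⟨i, hi⟩ := hx
  obtain ⟨j, hj⟩ := hy
  obtain ⟨k, hk⟩ : Even (x - y) := by
    have : Even (x ^ 2 - y ^ 2) := ⟨2 * (a * i - b * j), by linear_combination hi - hj⟩
    rw [Int.even_sub, Int.even_pow' two_ne_zero, Int.even_pow' two_ne_zero] at this
    rwa [Int.even_sub]
  have e1 : (x - 2 * a * u * k) ^ 2 - D = 4 * (a * (i - x * u * k + a * u ^ 2 * k ^ 2)) := by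
    linear_combination hi
  have e2 : x - 2 * a * u * k = y + 2 * b * v * k := by linear_combination hk - 2 * k * huv
  have e3 : (x - 2 * a * u * k) ^ 2 - D = 4 * (b * (j + y * v * k + b * v ^ 2 * k ^ 2)) := by
    rw [e2]; linear_combination hj
  have e4 := mul_left_cancel₀ four_ne_zero (e1.symm.trans e3)
  refine ⟨x - 2 * a * u * k, ?_⟩
  rw [e1]
  exact mul_dvd_mul_left _ (hab.mul_dvd (dvd_mul_right _ _) (e4 ▸ dvd_mul_right _ _))

theorem exists_sq_sub_of_squarefree (h4 : d % 4 = 0 ∨ d % 4 = 1) {k : ℕ} (e : ℕ)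
    (he : Squarefree e) (hpk : ∀ p : ℕ, p.Prime → p ∣ e → ¬ p ∣ k ∧ kroneckerAtPrime d p ≠ -1) :
    ∃ b : ℤ, 4 * (e : ℤ) ∣ b ^ 2 - (k : ℤ) ^ 2 * d := by
  induction e using induction_on_primes with
  | zero => simp at he
  | one =>
    refine ⟨k * d, ?_⟩
    have : 4 ∣ d * (d - 1) := by
      rcases h4 with h | h
      · exact (Int.dvd_of_emod_eq_zero h).mul_right _
      · exact (show (4 : ℤ) ∣ d - 1 by omega).mul_left _
    rw [show ((k : ℤ) * d) ^ 2 - k ^ 2 * d = k ^ 2 * (d * (d - 1)) by ring]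
    simpa using this.mul_left _
  | prime_mul p a hp ih =>
    obtain ⟨x, hx⟩ := exists_sq_sub_of_prime h4 hp (hpk p hp (dvd_mul_right _ _)).1
      (hpk p hp (dvd_mul_right _ _)).2
    obtain ⟨y, hy⟩ := ih (he.squarefree_of_dvd (dvd_mul_left _ _))
      fun q hq hqa => hpk q hq (hqa.mul_left _)
    have := exists_sq_sub_mul
      (Nat.isCoprime_iff_coprime.2 (Nat.coprime_of_squarefree_mul he)) hx hy
    exact_mod_cast this

end inert

/-- The local conditions for `n` to be coprime to `k` and to be represented by some form of
discriminant `k ^ 2 * d`. -/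
def LocallyRepresented (d : ℤ) (k n : ℕ) : Prop :=
  n.Coprime k ∧ ∀ p : ℕ, p.Prime → kroneckerAtPrime d p = -1 → Even (n.factorization p)

theorem locallyRepresented_of_eval {D D' : ℤ} (hD : IsDiscriminant D) {k n : ℕ}
    (hD' : D' = (k : ℤ) ^ 2 * fundDisc D) (hn : n ≠ 0) (hco : n.Coprime k) {F : PrimForm D'}
    {x y : ℤ} (h : F.eval x y = n) : LocallyRepresented (fundDisc D) k n := by
  refine ⟨hco, fun p hp hin => ?_⟩
  by_cases hpn : p ∣ n
  · exact F.even_factorization_of_inert (fundDisc_emod_four hD) hp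
      (fun hpk => hp.not_dvd_one (hco ▸ Nat.dvd_gcd hpn hpk)) hD' hin hn h
  · rw [Nat.factorization_eq_zero_of_not_dvd hpn]
    exact Even.zero

/-! ### Represented integers and the number of genera representing them -/

section represented

variable {D D' : ℤ} (hD : IsDiscriminant D) (hneg : D < 0)

include hD hneg

/-- The primes of the squarefree part `e` of `n` are not inert and do not divide `k`, so `D'` is a
square modulo `4e`. The resulting form (e, b, c) is primitive, as a common prime would divide the
conductor of `D'`, and it takes the value `n = e s²` at (s, 0). -/
theorem LocallyRepresented.exists_form {k n : ℕ} (hk : k ≠ 0)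
    (hD' : D' = (k : ℤ) ^ 2 * fundDisc D) (hn : n ≠ 0)
    (h : LocallyRepresented (fundDisc D) k n) :
    ∃ (F : PrimForm D') (x y : ℤ), F.eval x y = n := by
  have h4 := fundDisc_emod_four hD
  have hneg' : D' < 0 := by
    rw [hD']
    exact mul_neg_of_pos_of_neg (by positivity) (fundDisc_neg hD hneg)
  obtain ⟨e, s, hes, he⟩ := Nat.sq_mul_squarefree n
  have he0 : e ≠ 0 := he.ne_zero
  have hs0 : s ≠ 0 := by rintro rfl; simp at hes; omega
  have hpk : ∀ p : ℕ, p.Prime → p ∣ e → ¬ p ∣ k ∧ kroneckerAtPrime (fundDisc D) p ≠ -1 := by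
    intro p hp hpe
    refine ⟨fun hpk => hp.not_dvd_one ?_, fun hin => ?_⟩
    · rw [← h.1]
      exact Nat.dvd_gcd (hes ▸ hpe.mul_left _) hpk
    · have h1 := h.2 p hp hin
      rw [← hes, Nat.factorization_mul (pow_ne_zero 2 hs0) he0, Nat.factorization_pow] at h1
      have h2 := he.natFactorization_le_one p
      have h3 := hp.factorization_pos_of_dvd he0 hpe
      have h4 : e.factorization p = 1 := by omega
      simp only [Finsupp.coe_add, Finsupp.coe_smul, Pi.add_apply, Pi.smul_apply, h4,
        smul_eq_mul] at h1
      rw [Nat.even_iff] at h1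
      omega
  obtain ⟨b, c, hc⟩ := exists_sq_sub_of_squarefree h4 e he hpk
  refine ⟨PrimForm.ofPos hneg' e b c (by positivity) (by rw [hD']; linear_combination hc) ?_,
    s, 0, ?_⟩
  · intro p hp h1 h2 h3
    refine not_dividesConductor_sq_mul_fundDisc hD hneg hp (hpk p hp (by exact_mod_cast h1)).1
      (DividesConductor.of_dvd (b := b) (a := e) (c := c) (by linear_combination hc) h2 ?_)
    rw [sq]
    exact mul_dvd_mul h1 h3
  · rw [← hes]
    simp [PrimForm.eval, PrimForm.ofPos, mul_comm]

theorem sq_mul_fundDisc {m k : ℕ} (hmk : discConductor D = m * k) :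
    D = (m : ℤ) ^ 2 * ((k : ℤ) ^ 2 * fundDisc D) ∧ 0 < m ∧ 0 < k ∧
      D / (m : ℤ) ^ 2 = (k : ℤ) ^ 2 * fundDisc D ∧ (k : ℤ) ^ 2 * fundDisc D < 0 ∧
      ((k : ℤ) ^ 2 * fundDisc D % 4 = 0 ∨ (k : ℤ) ^ 2 * fundDisc D % 4 = 1) := by
  have h0 := discConductor_sq_mul_fundDisc hD
  have hf := discConductor_pos hD
  have hm : 0 < m := Nat.pos_of_ne_zero (by rintro rfl; simp at hmk; omega)
  have hk : 0 < k := Nat.pos_of_ne_zero (by rintro rfl; simp at hmk; omega)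
  have h1 : D = (m : ℤ) ^ 2 * ((k : ℤ) ^ 2 * fundDisc D) := by
    conv_lhs => rw [← h0, hmk]
    push_cast
    ring
  refine ⟨h1, hm, hk, ?_, mul_neg_of_pos_of_neg (by positivity) (fundDisc_neg hD hneg), ?_⟩
  · exact Int.ediv_eq_of_eq_mul_right (pow_ne_zero 2 (by exact_mod_cast hm.ne')) h1
  · obtain ⟨d', h2, h3⟩ := DividesConductor.sq_mul_of_dvd (fundDisc_emod_four hD) (one_dvd k)
    rw [h2]
    simpa using h3

theorem genusRepCount_of_locallyRepresented {m k n : ℕ} (hmk : discConductor D = m * k)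
    (hn : n ≠ 0) (h : LocallyRepresented (fundDisc D) k n) :
    (genusRepCount (m ^ 2 * n) D : ℝ) =
      2 ^ ((genusExponent D : ℤ) - (genusExponent (D / (m : ℤ) ^ 2) : ℤ)) := by
  obtain ⟨h1, hm, hk, h2, h3, h4⟩ := sq_mul_fundDisc hD hneg hmk
  obtain ⟨F, x, y, hF⟩ := h.exists_form hD hneg hk.ne' rfl hn
  have key := genusRepCount_mul hneg hD.2 h3 h4 h1 hm hn (fun p hp hpn =>
    not_dividesConductor_sq_mul_fundDisc hD hneg hp
      (fun hpk => hp.not_dvd_one (h.1 ▸ Nat.dvd_gcd hpn hpk))) hF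
  rw [h2, zpow_sub₀ two_ne_zero, zpow_natCast, zpow_natCast, eq_div_iff (by positivity)]
  exact_mod_cast key

theorem exists_locallyRepresented {n : ℕ} (hn : n ≠ 0) (h : genusRepCount n D ≠ 0) :
    ∃ m ∈ (discConductor D).divisors, m ^ 2 ∣ n ∧
      LocallyRepresented (fundDisc D) (discConductor D / m) (n / m ^ 2) := by
  classical
  have hf := discConductor_pos hD
  -- With `m` maximal, `n / m²` is prime to `f / m`: a common prime `p` would divide `n / m²` twice,
  -- and `m p` would also qualify.
  obtain ⟨m, hm, hmax⟩ := Finset.exists_max_image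
    ((discConductor D).divisors.filter fun m => m ^ 2 ∣ n) id ⟨1, by simp [hf.ne']⟩
  simp only [Finset.mem_filter, Nat.mem_divisors, id] at hm hmax
  obtain ⟨⟨⟨k, hmk⟩, -⟩, ⟨n', hn'⟩⟩ := hm
  obtain ⟨h1, hm0, hk, h2, h3, h4⟩ := sq_mul_fundDisc hD hneg hmk
  have hn0 : n' ≠ 0 := by rintro rfl; simp at hn'; omega
  rw [Ne, genusRepCount_eq_zero_iff hneg] at h
  push Not at h
  obtain ⟨F, x, y, hF⟩ := h
  have hN : D.natAbs ≠ 0 := by omega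
  have hmN : m ∣ D.natAbs := by
    rw [← Int.natCast_dvd, h1, sq, mul_assoc]
    exact dvd_mul_right _ _
  obtain ⟨q, hq⟩ := F.values_nonempty hneg hN
  obtain ⟨F', -, hF'⟩ := exists_descent_of_mem_values hneg h1 h4 hm0 hmN hq
  obtain ⟨x', y', hxy⟩ := hF' x y n' (by rw [hF, hn']; push_cast; rfl)
  refine ⟨m, Nat.mem_divisors.2 ⟨⟨k, hmk⟩, hf.ne'⟩, ⟨n', hn'⟩, ?_⟩
  rw [hmk, Nat.mul_div_cancel_left _ hm0, hn', Nat.mul_div_cancel_left _ (by positivity)]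
  refine locallyRepresented_of_eval hD rfl hn0 ?_ hxy
  refine Nat.Coprime.symm (Nat.coprime_of_dvd fun p hp hpk hpn => ?_)
  have hsq := PrimForm.sq_dvd_of_dvd_eval h3 hp
    (DividesConductor.sq_mul_of_dvd (fundDisc_emod_four hD) hpk) F' hxy (by exact_mod_cast hpn)
  have hsq' : p ^ 2 ∣ n' := by exact_mod_cast hsq
  have := hmax (m * p) ⟨⟨hmk ▸ mul_dvd_mul_left m hpk, hf.ne'⟩, by
    rw [hn', mul_pow]; exact mul_dvd_mul_left _ hsq'⟩
  have := hp.two_le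
  nlinarith

open Classical in
/-- The number of genera representing `n`, as a sum over the divisors of the conductor in which
at most one term is nonzero. -/
theorem genusRepCount_eq_sum {n : ℕ} (hn : n ≠ 0) :
    (genusRepCount n D : ℝ) = ∑ m ∈ (discConductor D).divisors,
      if m ^ 2 ∣ n ∧ LocallyRepresented (fundDisc D) (discConductor D / m) (n / m ^ 2) then
        (2 : ℝ) ^ ((genusExponent D : ℤ) - (genusExponent (D / (m : ℤ) ^ 2) : ℤ)) else 0 := by
  by_cases hex : ∃ m ∈ (discConductor D).divisors, m ^ 2 ∣ n ∧
      LocallyRepresented (fundDisc D) (discConductor D / m) (n / m ^ 2)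
  · have huniq : ∀ m ∈ (discConductor D).divisors, (m ^ 2 ∣ n ∧
        LocallyRepresented (fundDisc D) (discConductor D / m) (n / m ^ 2)) →
        m ^ 2 = Nat.gcd n (discConductor D ^ 2) := by
      rintro m hm ⟨⟨n', rfl⟩, h⟩
      obtain ⟨k, hmk⟩ := Nat.dvd_of_mem_divisors hm
      obtain ⟨-, hm0, -⟩ := sq_mul_fundDisc hD hneg hmk
      rw [hmk, Nat.mul_div_cancel_left _ hm0, Nat.mul_div_cancel_left _ (by positivity)] at h
      rw [hmk, mul_pow, Nat.gcd_mul_left, (Nat.Coprime.pow_right 2 h.1 : Nat.gcd n' (k ^ 2) = 1),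
        mul_one]
    obtain ⟨m, hm, hmn⟩ := hex
    rw [Finset.sum_eq_single_of_mem m hm, if_pos hmn]
    · obtain ⟨⟨n', rfl⟩, h⟩ := hmn
      obtain ⟨k, hmk⟩ := Nat.dvd_of_mem_divisors hm
      obtain ⟨-, hm0, -⟩ := sq_mul_fundDisc hD hneg hmk
      rw [hmk, Nat.mul_div_cancel_left _ hm0, Nat.mul_div_cancel_left _ (by positivity)] at h
      exact genusRepCount_of_locallyRepresented hD hneg hmk (right_ne_zero_of_mul hn) h
    · intro m' hm' hne
      refine if_neg fun h => hne ?_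
      exact Nat.pow_left_injective two_ne_zero ((huniq m' hm' h).trans (huniq m hm hmn).symm)
  · rw [Finset.sum_eq_zero fun m hm => if_neg fun h => hex ⟨m, hm, h⟩]
    by_contra hne
    exact hex (exists_locallyRepresented hD hneg hn (by exact_mod_cast hne))

end represented

/-! ### The Euler products and the sum over `n ∣ D ^ ∞` -/

open Classical in
/-- The summand `1 / n` restricted to the locally represented integers. -/
noncomputable def localTerm (d : ℤ) (k n : ℕ) : ℝ :=
  if LocallyRepresented d k n then 1 / (n : ℝ) else 0

section euler

variable {d : ℤ} {k : ℕ}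

theorem locallyRepresented_one : LocallyRepresented d k 1 :=
  ⟨Nat.coprime_one_left k, fun p _ _ => by simp⟩

theorem locallyRepresented_mul {a b : ℕ} (ha : a ≠ 0) (hb : b ≠ 0) (hab : a.Coprime b) :
    LocallyRepresented d k (a * b) ↔ LocallyRepresented d k a ∧ LocallyRepresented d k b := by
  have key : ∀ p : ℕ, p.Prime → (Even ((a * b).factorization p) ↔
      Even (a.factorization p) ∧ Even (b.factorization p)) := by
    intro p hp
    rw [Nat.factorization_mul ha hb, Finsupp.coe_add, Pi.add_apply]
    by_cases hpa : p ∣ a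
    · have : ¬ p ∣ b := fun hpb => hp.not_dvd_one (hab ▸ Nat.dvd_gcd hpa hpb)
      simp [Nat.factorization_eq_zero_of_not_dvd this]
    · simp [Nat.factorization_eq_zero_of_not_dvd hpa]
  simp only [LocallyRepresented, Nat.coprime_mul_iff_left]
  constructor
  · rintro ⟨⟨h1, h2⟩, h3⟩
    exact ⟨⟨h1, fun p hp hi => ((key p hp).1 (h3 p hp hi)).1⟩,
      ⟨h2, fun p hp hi => ((key p hp).1 (h3 p hp hi)).2⟩⟩
  · rintro ⟨⟨h1, h2⟩, ⟨h3, h4⟩⟩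
    exact ⟨⟨h1, h3⟩, fun p hp hi => (key p hp).2 ⟨h2 p hp hi, h4 p hp hi⟩⟩

theorem localTerm_mul {a b : ℕ} (hab : a.Coprime b) :
    localTerm d k (a * b) = localTerm d k a * localTerm d k b := by
  -- At zero the summand is 0 in either case, because `1 / 0 = 0`.
  rcases eq_or_ne a 0 with rfl | ha
  · simp [localTerm]
  rcases eq_or_ne b 0 with rfl | hb
  · simp [localTerm]
  have h := locallyRepresented_mul (d := d) (k := k) ha hb hab
  by_cases h1 : LocallyRepresented d k a <;> by_cases h2 : LocallyRepresented d k b <;>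
    simp [localTerm, h, h1, h2, mul_comm]

theorem locallyRepresented_prime_pow {p : ℕ} (hp : p.Prime) (e : ℕ) :
    LocallyRepresented d k (p ^ e) ↔
      e = 0 ∨ (¬ p ∣ k ∧ (kroneckerAtPrime d p = -1 → Even e)) := by
  rcases eq_or_ne e 0 with rfl | he
  · simpa using locallyRepresented_one
  · simp only [LocallyRepresented, he, false_or, Nat.coprime_pow_left_iff (Nat.pos_of_ne_zero he),
      hp.coprime_iff_not_dvd, hp.factorization_pow]
    refine and_congr_right fun _ => ⟨fun h hi => by simpa using h p hp hi, fun h q hq hi => ?_⟩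
    by_cases hpq : p = q
    · subst hpq
      simpa using h hi
    · simp [hpq]

theorem hasSum_ite_even {r : ℝ} (h0 : 0 ≤ r) (h1 : r < 1) :
    HasSum (fun e : ℕ => if Even e then r ^ e else 0) (1 - r ^ 2)⁻¹ := by
  have hinj : Function.Injective fun e : ℕ => 2 * e := fun a b h => by simpa using h
  rw [← hinj.hasSum_iff]
  · have := hasSum_geometric_of_lt_one (sq_nonneg r) (by nlinarith : r ^ 2 < 1)
    simpa [Function.comp_def, pow_mul] using this
  · intro e he
    rw [if_neg]
    rintro ⟨j, hj⟩
    exact he ⟨j, by simp only; omega⟩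

-- The factor is written as a product of four so that the Euler product separates into the products
-- of the final formula; for `p ∣ k` they cancel to 1, the term `e = 0`.
open Classical in
theorem hasSum_localTerm_prime_pow {p : ℕ} (hp : p.Prime) :
    HasSum (fun e => localTerm d k (p ^ e))
      ((1 - (p : ℝ)⁻¹)⁻¹ * (if kroneckerAtPrime d p = -1 then 1 / (1 + 1 / (p : ℝ)) else 1) *
        ((if p ∣ k then 1 - 1 / (p : ℝ) else 1) *
          (if p ∣ k ∧ kroneckerAtPrime d p = -1 then 1 + 1 / (p : ℝ) else 1))) := by
  have hp0 : (0 : ℝ) < p := by exact_mod_cast hp.pos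
  have hp1 : (1 : ℝ) < p := by exact_mod_cast hp.one_lt
  have hr0 : (0 : ℝ) ≤ (p : ℝ)⁻¹ := by positivity
  have hr1 : (p : ℝ)⁻¹ < 1 := inv_lt_one_of_one_lt₀ hp1
  have hne : (1 : ℝ) - (p : ℝ)⁻¹ ≠ 0 := by linarith
  have hne' : (1 : ℝ) + (p : ℝ)⁻¹ ≠ 0 := by positivity
  have hterm : ∀ e, localTerm d k (p ^ e) =
      if e = 0 ∨ (¬ p ∣ k ∧ (kroneckerAtPrime d p = -1 → Even e)) then (p : ℝ)⁻¹ ^ e else 0 := by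
    intro e
    have := locallyRepresented_prime_pow (d := d) (k := k) hp e
    simp only [localTerm, this, Nat.cast_pow, one_div, inv_pow]
  simp only [hterm, one_div]
  by_cases hpk : p ∣ k
  · have h := hasSum_ite_eq (0 : ℕ) (1 : ℝ)
    have h1 : (1 - (p : ℝ)⁻¹)⁻¹ * (if kroneckerAtPrime d p = -1 then (1 + (p : ℝ)⁻¹)⁻¹ else 1) *
        ((if p ∣ k then 1 - (p : ℝ)⁻¹ else 1) *
          (if p ∣ k ∧ kroneckerAtPrime d p = -1 then 1 + (p : ℝ)⁻¹ else 1)) = 1 := by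
      by_cases hi : kroneckerAtPrime d p = -1 <;> simp only [hpk, hi, if_true, if_false, true_and]
      · generalize (p : ℝ)⁻¹ = r at *
        field_simp
      · generalize (p : ℝ)⁻¹ = r at *
        field_simp
    rw [h1]
    refine h.congr_fun ?_
    intro e
    by_cases he : e = 0 <;> simp [hpk, he]
  · simp only [hpk, not_false_eq_true, true_and, if_false, false_and, mul_one]
    by_cases hi : kroneckerAtPrime d p = -1
    · have h := hasSum_ite_even hr0 hr1
      have h1 : (1 - (p : ℝ)⁻¹)⁻¹ * (1 + (p : ℝ)⁻¹)⁻¹ = (1 - (p : ℝ)⁻¹ ^ 2)⁻¹ := by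
        rw [← mul_inv]; congr 1; ring
      rw [if_pos hi, h1]
      refine h.congr_fun ?_
      intro e
      by_cases he : Even e
      · simp [he]
      · have : e ≠ 0 := by rintro rfl; simp at he
        simp [he, hi, this]
    · simpa [hi] using hasSum_geometric_of_lt_one hr0 hr1

theorem norm_localTerm_le (n : ℕ) : ‖localTerm d k n‖ ≤ 1 / (n : ℝ) := by
  rw [localTerm]
  split_ifs
  · rw [Real.norm_of_nonneg (by positivity)]
  · rw [norm_zero]; positivity

theorem summable_norm_localTerm_prime_pow {p : ℕ} (hp : p.Prime) :
    Summable fun e => ‖localTerm d k (p ^ e)‖ := by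
  refine Summable.of_nonneg_of_le (fun _ => norm_nonneg _) (fun e => norm_localTerm_le _) ?_
  have hp1 : (1 : ℝ) < p := by exact_mod_cast hp.one_lt
  simpa using summable_geometric_of_lt_one (r := (p : ℝ)⁻¹) (by positivity) (inv_lt_one_of_one_lt₀ hp1)

/-! ### Summation over the integers dividing a power of `D` -/

theorem mem_factoredNumbers_primeFactors_iff {N n : ℕ} (hN : N ≠ 0) :
    n ∈ Nat.factoredNumbers N.primeFactors ↔ n ≠ 0 ∧ ∀ p : ℕ, p.Prime → p ∣ n → p ∣ N := by
  rw [Nat.mem_factoredNumbers]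
  refine and_congr_right fun hn => ?_
  constructor
  · exact fun h p hp hpn => Nat.dvd_of_mem_primeFactors (h p ((Nat.mem_primeFactorsList hn).2 ⟨hp, hpn⟩))
  · intro h p hp
    rw [Nat.mem_primeFactorsList hn] at hp
    exact Nat.mem_primeFactors.2 ⟨hp.1, h p hp.1 hp.2, hN⟩

theorem powDivisor_iff_mem_factoredNumbers {D : ℤ} (hD : D ≠ 0) (n : ℕ) :
    (0 < n ∧ ∃ k : ℕ, (n : ℤ) ∣ D ^ k) ↔ n ∈ Nat.factoredNumbers D.natAbs.primeFactors := by
  have hD' : D.natAbs ≠ 0 := Int.natAbs_ne_zero.2 hD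
  rw [mem_factoredNumbers_primeFactors_iff hD', Nat.pos_iff_ne_zero]
  refine and_congr_right fun hn => ?_
  simp only [Int.natCast_dvd, Int.natAbs_pow]
  constructor
  · rintro ⟨k, hk⟩ p hp hpn
    exact hp.dvd_of_dvd_pow (hpn.trans hk)
  · intro h
    -- The power `D ^ n` suffices, since each prime exponent of `n` is less than `n`.
    refine ⟨n, (Nat.factorization_le_iff_dvd hn (pow_ne_zero n hD')).1 fun p => ?_⟩
    rw [Nat.factorization_pow, Finsupp.coe_smul, Pi.smul_apply, smul_eq_mul]
    by_cases hp : p.Prime ∧ p ∣ n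
    · have h1 := Nat.factorization_lt p hn
      have h2 := hp.1.factorization_pos_of_dvd hD' (h p hp.1 hp.2)
      nlinarith
    · rcases not_and_or.1 hp with hp | hp
      · simp [Nat.factorization_eq_zero_of_not_prime _ hp]
      · simp [Nat.factorization_eq_zero_of_not_dvd hp]

open Classical in
/-- The Euler product of the locally represented integers composed of the primes of `N`. -/
theorem hasSum_localTerm {N : ℕ} (hN : N ≠ 0) (hk : k ∣ N) :
    HasSum (fun n : Nat.factoredNumbers N.primeFactors => localTerm d k n)
      ((N : ℝ) / (Nat.totient N : ℝ) *
        (∏ p ∈ N.primeFactors with kroneckerAtPrime d p = -1, 1 / (1 + 1 / (p : ℝ))) *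
        ((∏ p ∈ k.primeFactors, (1 - 1 / (p : ℝ))) *
          (∏ p ∈ k.primeFactors with kroneckerAtPrime d p = -1, (1 + 1 / (p : ℝ))))) := by
  have h1 : localTerm d k 1 = 1 := by simp [localTerm, locallyRepresented_one]
  have h := (EulerProduct.summable_and_hasSum_factoredNumbers_prod_filter_prime_tsum h1
    localTerm_mul summable_norm_localTerm_prime_pow N.primeFactors).2
  rw [Finset.filter_true_of_mem fun p hp => Nat.prime_of_mem_primeFactors hp,
    Finset.prod_congr rfl fun p hp =>
      (hasSum_localTerm_prime_pow (Nat.prime_of_mem_primeFactors hp)).tsum_eq] at h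
  refine (congrArg (HasSum _ · _) ?_).mpr h
  have hkN : k.primeFactors = N.primeFactors.filter fun p => p ∣ k := by
    ext p
    have hk0 : k ≠ 0 := fun h => hN (by simpa [h] using hk)
    simp only [Nat.mem_primeFactors, Finset.mem_filter]
    exact ⟨fun ⟨a, b, _⟩ => ⟨⟨a, b.trans hk, hN⟩, b⟩, fun ⟨⟨a, _, _⟩, b⟩ => ⟨a, b, hk0⟩⟩
  rw [Finset.prod_mul_distrib, Finset.prod_mul_distrib, Finset.prod_mul_distrib, hkN,
    Finset.filter_filter, Finset.prod_filter, Finset.prod_filter, Finset.prod_filter]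
  congr 2
  have ht : ((N.totient : ℕ) : ℝ) = N * ∏ p ∈ N.primeFactors, (1 - (p : ℝ)⁻¹) := by
    have := congrArg (fun q : ℚ => (q : ℝ)) (Nat.totient_eq_mul_prod_factors N)
    push_cast at this
    exact this
  rw [ht, Finset.prod_inv_distrib, div_mul_eq_div_div, div_self (by exact_mod_cast hN), one_div]

-- Multiplication by `m²` permutes the index set injectively into itself, and the summand vanishes
-- off its image.
open Classical in
theorem hasSum_localTerm_mul_sq {N m : ℕ} (hN : N ≠ 0) (hm : m ≠ 0) (hmN : m ∣ N) {a : ℝ}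
    (h : HasSum (fun n : Nat.factoredNumbers N.primeFactors => localTerm d k n) a) :
    HasSum (fun n : Nat.factoredNumbers N.primeFactors =>
      if m ^ 2 ∣ (n : ℕ) ∧ LocallyRepresented d k (n / m ^ 2) then 1 / ((n : ℕ) : ℝ) else 0)
      (1 / (m : ℝ) ^ 2 * a) := by
  have hm2 : 0 < m ^ 2 := by positivity
  have hmem : ∀ n : ℕ, m ^ 2 * n ∈ Nat.factoredNumbers N.primeFactors ↔
      n ∈ Nat.factoredNumbers N.primeFactors := by
    intro n
    simp only [mem_factoredNumbers_primeFactors_iff hN, mul_ne_zero_iff, hm2.ne', ne_eq,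
      not_false_eq_true, true_and]
    refine and_congr_right fun _ => ⟨fun h p hp hpn => h p hp (hpn.mul_left _),
      fun h p hp hpn => ?_⟩
    rcases hp.dvd_mul.1 hpn with h1 | h1
    · exact (hp.dvd_of_dvd_pow h1).trans hmN
    · exact h p hp h1
  let ι : Nat.factoredNumbers N.primeFactors → Nat.factoredNumbers N.primeFactors :=
    fun n => ⟨m ^ 2 * n, (hmem n).2 n.2⟩
  have hι : Function.Injective ι := fun a b hab =>
    Subtype.ext (Nat.eq_of_mul_eq_mul_left hm2 (congrArg Subtype.val hab))
  rw [← hι.hasSum_iff]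
  · refine (h.mul_left (1 / (m : ℝ) ^ 2)).congr_fun fun n => ?_
    simp only [Function.comp, ι, localTerm, Nat.mul_div_cancel_left _ hm2, dvd_mul_right, true_and,
      mul_ite, mul_zero, Nat.cast_mul, Nat.cast_pow]
    congr 1
    rw [one_div_mul_one_div]
  · rintro ⟨n, hn⟩ hn'
    rw [if_neg]
    rintro ⟨⟨j, rfl⟩, -⟩
    exact hn' ⟨⟨j, (hmem j).1 hn⟩, rfl⟩

end euler

/-- The divisors `m` of the conductor are finite in number, so the series is summed one `m` at a
time, which gives convergence and value together. -/
theorem hasSum_genusRepCount {D : ℤ} (hD : IsDiscriminant D) (hneg : D < 0) :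
    HasSum (fun n : PowDivisor D => (genusRepCount n.1 D : ℝ) / (n.1 : ℝ))
      ((D.natAbs : ℝ) / (Nat.totient D.natAbs : ℝ) *
        (∏ p ∈ D.natAbs.primeFactors with kroneckerAtPrime (fundDisc D) p = -1,
          1 / (1 + 1 / (p : ℝ))) *
        ∑ m ∈ (discConductor D).divisors,
          (2 : ℝ) ^ ((genusExponent D : ℤ) - (genusExponent (D / (m : ℤ) ^ 2) : ℤ)) /
              (m : ℝ) ^ 2 *
            (∏ p ∈ (discConductor D / m).primeFactors, (1 - 1 / (p : ℝ))) *
            (∏ p ∈ (discConductor D / m).primeFactors with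
                kroneckerAtPrime (fundDisc D) p = -1, (1 + 1 / (p : ℝ)))) := by
  classical
  have hN : D.natAbs ≠ 0 := Int.natAbs_ne_zero.2 hneg.ne
  have hfN : discConductor D ∣ D.natAbs := by
    rw [← Int.natCast_dvd]
    exact (dvd_pow_self _ two_ne_zero).trans (discConductor_mem hD).1.2.1
  let ε : PowDivisor D ≃ Nat.factoredNumbers D.natAbs.primeFactors :=
    Equiv.subtypeEquivRight (powDivisor_iff_mem_factoredNumbers hneg.ne)
  have hsum : HasSum (fun n : Nat.factoredNumbers D.natAbs.primeFactors =>
      ∑ m ∈ (discConductor D).divisors,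
        (2 : ℝ) ^ ((genusExponent D : ℤ) - (genusExponent (D / (m : ℤ) ^ 2) : ℤ)) *
          if m ^ 2 ∣ (n : ℕ) ∧ LocallyRepresented (fundDisc D) (discConductor D / m) (n / m ^ 2)
            then 1 / ((n : ℕ) : ℝ) else 0) _ :=
    hasSum_sum fun m hm => (hasSum_localTerm_mul_sq hN
      (Nat.pos_of_mem_divisors hm).ne' ((Nat.dvd_of_mem_divisors hm).trans hfN)
      (hasSum_localTerm hN ((Nat.div_dvd_of_dvd (Nat.dvd_of_mem_divisors hm)).trans hfN))).mul_left _
  rw [← ε.hasSum_iff] at hsum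
  convert hsum using 1
  · ext n
    have hn : n.1 ≠ 0 := n.2.1.ne'
    rw [genusRepCount_eq_sum hD hneg hn, Finset.sum_div]
    refine Finset.sum_congr rfl fun m _ => ?_
    change _ = _ * if m ^ 2 ∣ n.1 ∧
      LocallyRepresented (fundDisc D) (discConductor D / m) (n.1 / m ^ 2) then 1 / (n.1 : ℝ) else 0
    split_ifs
    · rw [mul_one_div]
    · simp
  · rw [Finset.mul_sum]
    refine Finset.sum_congr rfl fun m _ => ?_
    ring

theorem kroneckerAtPrime_eq_zero_of_dvd {d : ℤ} {p : ℕ} (hp : p.Prime) (h : (p : ℤ) ∣ d) :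
    kroneckerAtPrime d p = 0 := by
  rw [kroneckerAtPrime]
  split_ifs with h2
  · subst h2
    rw [ZMod.χ₈_int_eq_if_mod_eight, if_pos (Int.emod_eq_zero_of_dvd (by exact_mod_cast h))]
  · have := Fact.mk hp
    rw [← jacobiSym.legendreSym.to_jacobiSym, legendreSym.eq_zero_iff,
      ZMod.intCast_zmod_eq_zero_iff_dvd]
    exact h

theorem mainTheorem5 (D : ℤ) (hD : IsDiscriminant D) (hneg : D < 0) :
    Nat.card (Genus D) = 2 ^ genusExponent D ∧
    Summable (fun n : PowDivisor D => (genusRepCount n.1 D : ℝ) / (n.1 : ℝ)) ∧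
    genusSum D =
      (D.natAbs : ℝ) / (Nat.totient D.natAbs : ℝ) *
        (∏ p ∈ D.natAbs.primeFactors with kroneckerAtPrime (fundDisc D) p = -1,
          1 / (1 + 1 / (p : ℝ))) *
        ∑ m ∈ (discConductor D).divisors,
          (2 : ℝ) ^ ((genusExponent D : ℤ) - (genusExponent (D / (m : ℤ) ^ 2) : ℤ)) /
              (m : ℝ) ^ 2 *
            (∏ p ∈ (discConductor D / m).primeFactors, (1 - 1 / (p : ℝ))) *
            (∏ p ∈ (discConductor D / m).primeFactors with
                kroneckerAtPrime (fundDisc D) p = -1, (1 + 1 / (p : ℝ))) ∧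
    (IsFundamentalDiscriminant D →
      genusSum D = (D.natAbs : ℝ) / (Nat.totient D.natAbs : ℝ)) := by
  have h := hasSum_genusRepCount hD hneg
  refine ⟨Genus.card_eq_two_pow hneg hD.2, h.summable, h.tsum_eq, fun hfund => ?_⟩
  have hf : discConductor D = 1 := hfund.2
  have hd : fundDisc D = D := by simp [fundDisc, hf]
  -- For fundamental `D` one has `d₀ = D`, so no prime factor of `D` is inert, and only `m = 1`
  -- remains.
  have hempty : (D.natAbs.primeFactors.filter fun p => kroneckerAtPrime (fundDisc D) p = -1) = ∅ := by
    refine Finset.filter_eq_empty_iff.2 fun p hp => ?_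
    rw [hd, kroneckerAtPrime_eq_zero_of_dvd (Nat.prime_of_mem_primeFactors hp)
      (Int.natCast_dvd.2 (Nat.dvd_of_mem_primeFactors hp))]
    decide
  rw [genusSum, h.tsum_eq, hempty, hf]
  simp
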